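/- Let $C$ be a (locally small) triangulated category and let $w=(C_{w\le 0},C_{w\ge 0})$ be a weight structure on $C$ in the homological convention: both classes are closed under retracts, $C_{w\le 0}\subset C_{w\le 0}[1]$, $C_{w\ge 0}[1]\subset C_{w\ge 0}$, $C_{w\le 0}\perp C_{w\ge 0}[1]$, and every object $M$ lies in a distinguished triangle $L\to M\to R\to L[1]$ with $L\in C_{w\le 0}$ and $R\in C_{w\ge 0}[1]$. (Here $D\perp E$ means $C(X,Y)=0$ for all $X\in D$, $Y\in E$.) Its heart $Hw$ is the full subcategory on $C_{w\le 0}\cap C_{w\ge 0}$. All products and coproducts are small, and $t$-structures $(C_{t\le 0},C_{t\ge 0})$ are in the homological convention as well: $C_{t\ge 0}[1]\subset C_{t\ge 0}$, $C_{t\ge 0}[1]\perp C_{t\le 0}$, $C_{t\le n}=C_{t\le 0}[n]$, $C_{t\ge n}=C_{t\ge 0}[n]$. Assume that $w$ is cosmashing, i.e. $C$ has all products and $C_{w\le 0}$ is closed under products, and that $C$ satisfies dual Brown representability, i.e. $C$ has all products and every homological functor $C\to \mathrm{Ab}$ that respects products is corepresentable. 1. The category $C$ has all coproducts, and there exists a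 $t$-structure $t^r$ on $C$ that is smashing (i.e. $C_{t^r\le 0}$ is closed under coproducts) and right adjacent to $w$, i.e. $C_{t^r\ge 1}\perp C_{w\le 0}$ and $C_{t^r\le -1}\perp C_{w\ge 0}$. The opposite of the heart of $t^r$ is equivalent to the category of those additive functors $Hw\to\mathrm{Ab}$ that respect products. 2. For an infinite cardinal $\alpha$, an object $M$ of $C$ is called $\alpha$-small if for every family $(N_i)_{i\in I}$ of objects of $C$ the canonical maps exhibit $C(M,\coprod_{i\in I}N_i)$ as the colimit of the groups $C(M,\coprod_{j\in J}N_j)$ over the subsets $J\subset I$ of cardinality less than $\alpha$. The full subcategory $C^{(\alpha)}$ of $\alpha$-small objects is a triangulated subcategory of $C$. 3. Assume in addition that $w$ is smashing, i.e. $C$ has all coproducts and $C_{w\ge 0}$ is closed under coproducts. Then for every infinite cardinal $\alpha$ the $t$-structure $t^r$ restricts to $C^{(\alpha)}$, i.e. $(C_{t^r\le 0}\cap C^{(\alpha)},\,C_{t^r\ge 0}\cap C^{(\alpha)})$ is a $t$-structure $t^{(\alpha)}$ on $C^{(\alpha)}$. Moreover, $t^{(\alpha)}$ is anti-orthogonal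 to $w$, and it is the only $t$-structure $t'$ on $C^{(\alpha)}$ that is anti-orthogonal to $w$, i.e. such that $C^{(\alpha)}_{t'\ge 1}\perp C_{w\le 0}$ and $C^{(\alpha)}_{t'\le -1}\perp C_{w\ge 0}$. -/

import Mathlib

open CategoryTheory CategoryTheory.Limits CategoryTheory.Pretriangulated
  CategoryTheory.Triangulated

universe v u v' u'

namespace WeightT

section WeightStructures

variable (C : Type u) [Category.{v} C] [Preadditive C] [HasZeroObject C] [HasShift C ℤ]
  [∀ n : ℤ, (shiftFunctor C n).Additive] [Pretriangulated C]

/-- A weight structure `w` on a triangulated category, in the homological convention: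
`nonpos` is the class `C_{w ≤ 0}` and `nonneg` is the class `C_{w ≥ 0}`.
Recall that `P.shift a` is the class of all `X` such that `X⟦a⟧` belongs to `P`; so, for a class `P`
closed under isomorphisms, the class `P[i]` is `P.shift (-i)`. -/
structure WeightStructure where
  /-- the class `C_{w ≤ 0}` -/
  nonpos : ObjectProperty C
  /-- the class `C_{w ≥ 0}` -/
  nonneg : ObjectProperty C
  nonpos_retract : nonpos.IsStableUnderRetracts
  nonneg_retract : nonneg.IsStableUnderRetracts
  /-- `C_{w ≤ 0} ⊆ C_{w ≤ 0}[1]` -/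
  nonpos_le_shift : nonpos ≤ nonpos.shift (-1 : ℤ)
  /-- `C_{w ≥ 0}[1] ⊆ C_{w ≥ 0}` -/
  shift_le_nonneg : nonneg.shift (-1 : ℤ) ≤ nonneg
  /-- `C_{w ≤ 0} ⊥ C_{w ≥ 0}[1]` -/
  orthogonal : ∀ ⦃X Y : C⦄ (f : X ⟶ Y), nonpos X → nonneg.shift (-1 : ℤ) Y → f = 0
  /-- existence of weight decompositions `L ⟶ M ⟶ R ⟶ L⟦1⟧` -/
  exists_decomposition : ∀ M : C, ∃ (L R : C) (f : L ⟶ M) (g : M ⟶ R) (h : R ⟶ L⟦(1 : ℤ)⟧),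
    Triangle.mk f g h ∈ distTriang C ∧ nonpos L ∧ nonneg.shift (-1 : ℤ) R

/-- The dual Brown representability property: all small products exist in `C`, and any homological
functor from `C` to abelian groups that respects small products is corepresentable. -/
def DualBrownRepresentability : Prop :=
  HasProducts.{v} C ∧
    ∀ H : C ⥤ AddCommGrpCat.{v}, H.IsHomological →
      (∀ I : Type v, PreservesLimitsOfShape (Discrete I) H) →
      ∃ M : C, Nonempty (preadditiveCoyoneda.obj (Opposite.op M) ≅ H)

end WeightStructures

section

variable {C : Type u} [Category.{v} C] [Preadditive C] [HasZeroObject C] [HasShift C ℤ]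
  [∀ n : ℤ, (shiftFunctor C n).Additive] [Pretriangulated C]

namespace WeightStructure

variable (w : WeightStructure C)

/-- The heart `Hw` of a weight structure: its class of objects is `C_{w ≤ 0} ∩ C_{w ≥ 0}`. -/
def heart : ObjectProperty C := w.nonpos ⊓ w.nonneg

/-- `w` is smashing: all small coproducts exist in `C`, and `C_{w ≥ 0}` is closed under them. -/
def IsSmashing : Prop :=
  HasCoproducts.{v} C ∧ ∀ I : Type v, w.nonneg.IsClosedUnderColimitsOfShape (Discrete I)

/-- `w` is cosmashing: all small products exist in `C`, and `C_{w ≤ 0}` is closed under them. -/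
def IsCosmashing : Prop :=
  HasProducts.{v} C ∧ ∀ I : Type v, w.nonpos.IsClosedUnderLimitsOfShape (Discrete I)

/-- The category of additive functors from the heart of `w` to abelian groups that respect
small products, as a full subcategory of the category of all functors. -/
def productPreserving : ObjectProperty (w.heart.FullSubcategory ⥤ AddCommGrpCat.{v}) :=
  fun F ↦ F.Additive ∧ ∀ I : Type v, PreservesLimitsOfShape (Discrete I) F

end WeightStructure

/-- The class `C_{t ≤ n}` in the homological convention. Mathlib uses the cohomological one, where
this class is denoted `C^{≥ -n}`. -/
def homLE (t : TStructure C) (n : ℤ) : ObjectProperty C := t.ge (-n)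

/-- The class `C_{t ≥ n}` in the homological convention. Mathlib uses the cohomological one, where
this class is denoted `C^{≤ -n}`. -/
def homGE (t : TStructure C) (n : ℤ) : ObjectProperty C := t.le (-n)

/-- A `t`-structure is smashing if all small coproducts exist in `C` and `C_{t ≤ 0}` is closed under
them. -/
def IsSmashingTStructure (t : TStructure C) : Prop :=
  HasCoproducts.{v} C ∧ ∀ I : Type v, (homLE t 0).IsClosedUnderColimitsOfShape (Discrete I)

/-- Let `w` be a weight structure on `C` and `t` a `t`-structure on `C'`, where `C'` is a full
triangulated subcategory of `C` with embedding `F`. Then `w` and `t` are anti-orthogonal if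
`C'_{t ≥ 1} ⊥ C_{w ≤ 0}` and `C'_{t ≤ -1} ⊥ C_{w ≥ 0}` in `C`. -/
def AntiOrthogonal {C' : Type u'} [Category.{v'} C'] [Preadditive C'] [HasZeroObject C']
    [HasShift C' ℤ] [∀ n : ℤ, (shiftFunctor C' n).Additive] [Pretriangulated C']
    (F : C' ⥤ C) (w : WeightStructure C) (t : TStructure C') : Prop :=
  (∀ (X : C') (Y : C) (f : F.obj X ⟶ Y), homGE t 1 X → w.nonpos Y → f = 0) ∧
  (∀ (X : C') (Y : C) (f : F.obj X ⟶ Y), homLE t (-1) X → w.nonneg Y → f = 0)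

/-- `t` is right adjacent to `w`: they are anti-orthogonal and defined on the same category. -/
def RightAdjacent (w : WeightStructure C) (t : TStructure C) : Prop :=
  AntiOrthogonal (𝟭 C) w t

end

section Small

variable {C : Type u} [Category.{v} C] [HasCoproducts.{v} C]

/-- For a family `N` of objects indexed by `I`, the functor that sends a subset `J` of `I` of
cardinality less than `α` to the coproduct of the `N j` for `j ∈ J`. -/
noncomputable def partialCoproducts {I : Type v} (N : I → C) (α : Cardinal.{v}) :
    {J : Set I // Cardinal.mk J < α} ⥤ C where
  obj J := ∐ fun j : J.1 ↦ N j
  map {J K} f := Sigma.map' (Set.inclusion (leOfHom f)) (fun j ↦ 𝟙 (N j))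

/-- The obvious cocone from the partial coproducts to the coproduct of the whole family. -/
noncomputable def partialCoproductsCocone {I : Type v} (N : I → C) (α : Cardinal.{v}) :
    Cocone (partialCoproducts N α) where
  pt := ∐ N
  ι :=
    { app := fun J ↦ Sigma.map' (fun j : J.1 ↦ (j : I)) (fun j ↦ 𝟙 (N j))
      naturality := by
        intro J K f
        apply Sigma.hom_ext
        intro j
        simp [partialCoproducts] }

/-- A functor `H` is `α`-small if, for any small family, the value of `H` on the coproduct is the
colimit of its values on the coproducts of the subfamilies of cardinality less than `α`. -/
def IsSmallFunctor (α : Cardinal.{v}) {A : Type u'} [Category.{v'} A] (H : C ⥤ A) : Prop :=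
  ∀ (I : Type v) (N : I → C), Nonempty (IsColimit (H.mapCocone (partialCoproductsCocone N α)))

variable (C) in
/-- The class `C^{(α)}` of `α`-small objects: those `M` for which the functor `C(M, -)` to abelian
groups is `α`-small. -/
def smallObjects [Preadditive C] (α : Cardinal.{v}) : ObjectProperty C :=
  fun M ↦ IsSmallFunctor α (preadditiveCoyoneda.obj (Opposite.op M))

end Small

end WeightT

/-! The t-structure has t_{≤0} = C_{w≤0} and t_{≥1} = ⊥C_{w≤0}, so its truncations come from
reflections to C_{w≤0}. To reflect M, restrict C(M,-) to C_{w≤0}: this is half exact and respects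
products. Its left Kan extension to C is homological and respects products, because weight
decompositions supply weakly terminal objects over each X and fibres supply weak pullbacks inside
C_{w≤0}. Dual Brown representability yields a corepresenting object B, which lies in C_{w≤0} because
the extension vanishes on C_{w≥1} (`exists_corepresenting_object`). Since C_{w≤0} is closed under
extensions, the fibre of M ⟶ B lies in ⊥C_{w≤0} (`exists_reflection_triangle`).

For the heart, a product-preserving F on Hw is first extended to C_{w≤0} by right Kan extension,
computed from triangles Y ⟶ Q ⟶ W with Q in Hw and W in C_{w≤0}. The result is again half exact and
respects products, so the same theorem gives an object B, which turns out to lie in the heart of t.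

An object is α-small iff its morphisms to coproducts factor through fewer than α summands. If w is
smashing, a morphism from the reflection B of M to ∐ N_i lifts to ∐ L_i with L_i in C_{w≤0}, where
morphisms from B and from M agree; so B inherits smallness from M
(`IsSmashing.factorsThroughSmall_of_distTriang`). Uniqueness holds because anti-orthogonality places
both halves of t' inside those of the induced t-structure, and nested t-structures coincide. -/

namespace WeightT

/-! ### Products and functors to abelian groups, in terms of elements. -/

section ProductsOfGroups

variable {D : Type u'} [Category.{v'} D]

/-- A functor to abelian groups that preserves a product is bijective on families of elements. -/
lemma existsUnique_of_preservesLimit {I : Type v} (G : D ⥤ AddCommGrpCat.{v})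
    [PreservesLimitsOfShape (Discrete I) G] {X : I → D} {c : Fan X} (hc : IsLimit c)
    (y : ∀ i, G.obj (X i)) : ∃! x : G.obj c.pt, ∀ i, G.map (c.proj i) x = y i := by
  let hc' := isLimitOfPreserves (G ⋙ forget AddCommGrpCat.{v}) hc
  let s : (Discrete.functor X ⋙ G ⋙ forget AddCommGrpCat.{v}).sections :=
    ⟨fun i ↦ y i.as, by
      rintro ⟨i⟩ ⟨j⟩ ⟨⟨h⟩⟩
      obtain rfl : i = j := h
      exact ConcreteCategory.congr_hom (G.map_id (X i)) (y i)⟩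
  refine ⟨(Types.isLimitEquivSections hc').symm s, fun i ↦ ?_, fun x hx ↦ ?_⟩
  · exact Types.isLimitEquivSections_symm_apply hc' s ⟨i⟩
  · apply (Types.isLimitEquivSections hc').injective
    rw [Equiv.apply_symm_apply]
    apply Subtype.ext
    funext ⟨i⟩
    exact hx i

/-- A functor to abelian groups that is bijective on families of elements of products preserves
products. -/
lemma preservesLimitsOfShape_of_existsUnique {I : Type v} [HasLimitsOfShape (Discrete I) D]
    (G : D ⥤ AddCommGrpCat.{v})
    (h : ∀ (X : I → D) (y : ∀ i, G.obj (X i)),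
      ∃! x : G.obj (∏ᶜ X), ∀ i, G.map (Pi.π X i) x = y i) :
    PreservesLimitsOfShape (Discrete I) G := by
  have (X : I → D) :
      PreservesLimit (Discrete.functor X) (G ⋙ forget AddCommGrpCat.{v}) := by
    refine preservesLimit_of_preserves_limit_cone (productIsProduct X) (Nonempty.some ?_)
    rw [Types.isLimit_iff]
    intro s _
    obtain ⟨x, hx, hx'⟩ := h X (fun i ↦ s ⟨i⟩)
    exact ⟨x, fun ⟨i⟩ ↦ hx i, fun z hz ↦ hx' z fun i ↦ hz ⟨i⟩⟩
  have : PreservesLimitsOfShape (Discrete I) (G ⋙ forget AddCommGrpCat.{v}) :=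
    preservesLimitsOfShape_of_discrete _
  exact preservesLimitsOfShape_of_reflects_of_preserves G (forget AddCommGrpCat.{v})

end ProductsOfGroups

section Triangles

variable {C : Type u} [Category.{v} C] [Preadditive C] [HasZeroObject C] [HasShift C ℤ]
  [∀ n : ℤ, (shiftFunctor C n).Additive] [Pretriangulated C]
  {X Y Z A : C} {f : X ⟶ Y} {g : Y ⟶ Z} {h : Z ⟶ X⟦(1 : ℤ)⟧}

lemma comp_eq_zero_of_distTriang (hT : Triangle.mk f g h ∈ distTriang C) : f ≫ g = 0 :=
  comp_distTriang_mor_zero₁₂ _ hT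

lemma exists_lift_of_distTriang (hT : Triangle.mk f g h ∈ distTriang C) (a : A ⟶ Y)
    (ha : a ≫ g = 0) : ∃ b : A ⟶ X, b ≫ f = a := by
  obtain ⟨b, hb⟩ := Triangle.coyoneda_exact₂ _ hT a ha
  exact ⟨b, hb.symm⟩

lemma exists_desc_of_distTriang (hT : Triangle.mk f g h ∈ distTriang C) (a : Y ⟶ A)
    (ha : f ≫ a = 0) : ∃ b : Z ⟶ A, g ≫ b = a := by
  obtain ⟨b, hb⟩ := Triangle.yoneda_exact₂ _ hT a ha
  exact ⟨b, hb.symm⟩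

/-- Given a distinguished triangle `X ⟶ Y ⟶ Z ⟶ X⟦1⟧`, a morphism `X ⟶ A` extends to `Y` if there
are no nonzero morphisms from `Z⟦-1⟧` to `A`. -/
lemma exists_extension_of_distTriang (hT : Triangle.mk f g h ∈ distTriang C) (a : X ⟶ A)
    (hA : ∀ b : Z⟦(-1 : ℤ)⟧ ⟶ A, b = 0) : ∃ b : Y ⟶ A, f ≫ b = a := by
  obtain ⟨b, hb⟩ := Triangle.yoneda_exact₂ _ (inv_rot_of_distTriang _ hT) a (hA _)
  exact ⟨b, hb.symm⟩

end Triangles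

/-! ### Orthogonality in weight structures and approximation by the heart. -/

namespace WeightStructure

variable {C : Type u} [Category.{v} C] [Preadditive C] [HasZeroObject C] [HasShift C ℤ]
  [∀ n : ℤ, (shiftFunctor C n).Additive] [Pretriangulated C] (w : WeightStructure C)

instance : w.nonpos.IsStableUnderRetracts := w.nonpos_retract

instance : w.nonneg.IsStableUnderRetracts := w.nonneg_retract

/-- The class `C_{w ≥ 1}`. -/
def pos : ObjectProperty C := w.nonneg.shift (-1 : ℤ)

instance : w.pos.IsClosedUnderIsomorphisms := by
  unfold pos
  infer_instance

lemma pos_shift_iff (X : C) : w.pos (X⟦(1 : ℤ)⟧) ↔ w.nonneg X :=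
  w.nonneg.prop_iff_of_iso ((shiftEquiv C (1 : ℤ)).unitIso.symm.app X)

lemma nonpos_shift {X : C} (hX : w.nonpos X) : w.nonpos (X⟦(-1 : ℤ)⟧) :=
  w.nonpos_le_shift X hX

/-- If X ⟶ R vanishes in a weight decomposition, then X is a retract of L. -/
lemma nonpos_eq_leftOrthogonal : w.nonpos = w.pos.leftOrthogonal := by
  ext X
  refine ⟨fun hX Y f hY ↦ w.orthogonal f hX hY, fun hX ↦ ?_⟩
  obtain ⟨L, R, f, g, h, hT, hL, hR⟩ := w.exists_decomposition X
  obtain ⟨s, hs⟩ := exists_lift_of_distTriang hT (𝟙 X) (by rw [hX g hR, comp_zero])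
  exact w.nonpos.prop_of_retract ⟨s, f, hs⟩ hL

lemma pos_eq_rightOrthogonal : w.pos = w.nonpos.rightOrthogonal := by
  ext X
  refine ⟨fun hX Y f hY ↦ w.orthogonal f hY hX, fun hX ↦ ?_⟩
  obtain ⟨L, R, f, g, h, hT, hL, hR⟩ := w.exists_decomposition X
  obtain ⟨s, hs⟩ := exists_desc_of_distTriang hT (𝟙 X) (by rw [hX f hL, zero_comp])
  let r : Retract X R := ⟨g, s, hs⟩
  exact w.nonneg.prop_of_retract (r.map (shiftFunctor C (-1 : ℤ))) hR

instance : w.nonpos.IsTriangulatedClosed₂ := by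
  rw [nonpos_eq_leftOrthogonal]
  infer_instance

/-- `C_{w ≤ -1} ⊥ C_{w ≥ 0}` -/
lemma hom_eq_zero {X Y : C} (f : X ⟶ Y) (hX : w.nonpos (X⟦(1 : ℤ)⟧)) (hY : w.nonneg Y) :
    f = 0 := by
  apply (shiftFunctor C (1 : ℤ)).map_injective
  rw [Functor.map_zero]
  exact w.orthogonal _ hX ((w.pos_shift_iff Y).2 hY)

lemma nonpos_shift_shift {X : C} (hX : w.nonpos X) : w.nonpos ((X⟦(-1 : ℤ)⟧)⟦(1 : ℤ)⟧) :=
  w.nonpos.prop_of_iso ((shiftEquiv C (1 : ℤ)).counitIso.symm.app X) hX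

lemma nonpos_biprod {X Y : C} (hX : w.nonpos X) (hY : w.nonpos Y) : w.nonpos (X ⊞ Y) :=
  w.nonpos.ext_of_isTriangulatedClosed₂ _ (binaryBiproductTriangle_distinguished X Y) hX hY

/-- The fibre of a morphism between objects of `C_{w ≤ 0}` belongs to `C_{w ≤ 0}`. -/
lemma nonpos_of_distTriang {X Y Z : C} {f : X ⟶ Y} {g : Y ⟶ Z} {h : Z ⟶ X⟦(1 : ℤ)⟧}
    (hT : Triangle.mk f g h ∈ distTriang C) (hY : w.nonpos Y) (hZ : w.nonpos Z) : w.nonpos X :=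
  w.nonpos.ext_of_isTriangulatedClosed₂ _ (inv_rot_of_distTriang _ hT) (w.nonpos_shift hZ) hY

/-- Any `Y` in `C_{w ≤ 0}` has a morphism to an object of the heart whose cone is in
`C_{w ≤ 0}`. -/
lemma exists_heart_triangle {Y : C} (hY : w.nonpos Y) :
    ∃ (Q W : C) (p : Y ⟶ Q) (j : Q ⟶ W) (d : W ⟶ Y⟦(1 : ℤ)⟧),
      Triangle.mk p j d ∈ distTriang C ∧ w.heart Q ∧ w.nonpos W := by
  -- Decomposing Y⟦1⟧ rather than Y makes the fibre Q of W ⟶ Y⟦1⟧ an extension of W by Y, hence an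
  -- object of C_{w≤0}; the cone of the same morphism identifies Q⟦1⟧ with R, so Q is in C_{w≥0}.
  obtain ⟨W, R, d, g, h, hT, hW, hR⟩ := w.exists_decomposition (Y⟦(1 : ℤ)⟧)
  obtain ⟨Q, p, j, hT'⟩ := distinguished_cocone_triangle₂ d
  refine ⟨Q, W, p, j, d, hT', ⟨w.nonpos.ext_of_isTriangulatedClosed₂ _ hT' hY hW, ?_⟩, hW⟩
  obtain ⟨e, -⟩ := exists_iso_of_arrow_iso _ _ hT (rot_of_distTriang _ (rot_of_distTriang _ hT'))
    (Iso.refl _)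
  exact (w.pos_shift_iff Q).1 (w.pos.prop_of_iso (Triangle.π₃.mapIso e) hR)

end WeightStructure

end WeightT

namespace WeightT

namespace WeightStructure

variable {C : Type u} [Category.{v} C] [Preadditive C] [HasZeroObject C] [HasShift C ℤ]
  [∀ n : ℤ, (shiftFunctor C n).Additive] [Pretriangulated C] (w : WeightStructure C)

/-! ### Left Kan extension from C_{w≤0} to C, and corepresentability. -/

section LeftExtension

/-- A chosen object of `C_{w ≤ 0}` in a weight decomposition of `X`. -/
noncomputable def truncLE (X : C) : w.nonpos.FullSubcategory :=
  ⟨(w.exists_decomposition X).choose,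
    (w.exists_decomposition X).choose_spec.choose_spec.choose_spec.choose_spec.choose_spec.2.1⟩

/-- The morphism to `X` in a weight decomposition of `X`. -/
noncomputable def truncLEι (X : C) : (w.truncLE X).obj ⟶ X :=
  (w.exists_decomposition X).choose_spec.choose_spec.choose

/-- `truncLE X` is weakly terminal among objects of C_{w≤0} over X. Hence the colimit defining the
Kan extension at X is a quotient of the single group H(`truncLE X`). -/
lemma exists_lift_truncLEι {X : C} {L : w.nonpos.FullSubcategory} (f : L.obj ⟶ X) :
    ∃ l : L ⟶ w.truncLE X, l.hom ≫ w.truncLEι X = f := by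
  obtain ⟨g, h, hT, -, hR⟩ := (w.exists_decomposition X).choose_spec.choose_spec.choose_spec
  obtain ⟨l, hl⟩ := exists_lift_of_distTriang hT f (w.orthogonal _ L.property hR)
  exact ⟨ObjectProperty.homMk l, hl⟩

variable {w}
variable (H : w.nonpos.FullSubcategory ⥤ AddCommGrpCat.{v})

/-- A functor on `C_{w ≤ 0}` is half exact if it is exact on the distinguished triangles of objects
of `C_{w ≤ 0}`. -/
def IsHalfExact : Prop :=
  ∀ ⦃X Y Z : w.nonpos.FullSubcategory⦄ (f : X ⟶ Y) (g : Y ⟶ Z) (h : Z.obj ⟶ X.obj⟦(1 : ℤ)⟧),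
    Triangle.mk f.hom g.hom h ∈ distTriang C →
      ∀ y : H.obj Y, H.map g y = 0 → ∃ x : H.obj X, H.map f x = y

/-- A functor on `C_{w ≤ 0}` respects products if it respects those products in the ambient category
that are taken over small families of objects of `C_{w ≤ 0}`. -/
def RespectsProducts : Prop :=
  ∀ ⦃I : Type v⦄ (L : I → w.nonpos.FullSubcategory),
    ∃ (E : w.nonpos.FullSubcategory) (π : ∀ i, E ⟶ L i),
      Nonempty (IsLimit (Fan.mk E.obj fun i ↦ (π i).hom)) ∧
        ∀ y : ∀ i, H.obj (L i), ∃! x : H.obj E, ∀ i, H.map (π i) x = y i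

lemma map_comp_apply' {D : Type u'} [Category.{v'} D] (F : D ⥤ AddCommGrpCat.{v}) {X Y Z : D}
    (f : X ⟶ Y) (g : Y ⟶ Z) (x : F.obj X) : F.map (f ≫ g) x = F.map g (F.map f x) :=
  ConcreteCategory.congr_hom (F.map_comp f g) x

lemma map_id_apply' {D : Type u'} [Category.{v'} D] (F : D ⥤ AddCommGrpCat.{v}) {X : D}
    (x : F.obj X) : F.map (𝟙 X) x = x :=
  ConcreteCategory.congr_hom (F.map_id X) x

section

variable {D : Type u'} [Category.{v'} D] [Preadditive D] (F : D ⥤ AddCommGrpCat.{v}) [F.Additive]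
  {X Y : D}

lemma map_add_apply' (f g : X ⟶ Y) (x : F.obj X) : F.map (f + g) x = F.map f x + F.map g x :=
  ConcreteCategory.congr_hom (F.map_add (f := f) (g := g)) x

lemma map_sub_apply' (f g : X ⟶ Y) (x : F.obj X) : F.map (f - g) x = F.map f x - F.map g x :=
  ConcreteCategory.congr_hom (F.map_sub (f := f) (g := g)) x

lemma map_zero_apply' (x : F.obj X) : F.map (0 : X ⟶ Y) x = 0 :=
  ConcreteCategory.congr_hom (F.map_zero X Y) x

end

/-- The direct sum of two objects of `C_{w ≤ 0}`. -/
noncomputable def biprodNonpos (K L : w.nonpos.FullSubcategory) : w.nonpos.FullSubcategory :=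
  ⟨K.obj ⊞ L.obj, w.nonpos_biprod K.property L.property⟩

/-- The elements of `H(L)` that come from some `K ⟶ L` whose composition with `f : L ⟶ X`
vanishes. -/
def vanishing (L : w.nonpos.FullSubcategory) {X : C} (f : L.obj ⟶ X) :
    AddSubgroup (H.obj L) where
  carrier := {y | ∃ (K : w.nonpos.FullSubcategory) (k : K ⟶ L) (u : H.obj K),
    k.hom ≫ f = 0 ∧ H.map k u = y}
  zero_mem' := ⟨L, 0, 0, by simp, map_zero _⟩
  neg_mem' := by
    rintro _ ⟨K, k, u, hk, rfl⟩
    exact ⟨K, k, -u, hk, map_neg _ _⟩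
  add_mem' := by
    rintro _ _ ⟨K, k, u, hk, rfl⟩ ⟨K', k', u', hk', rfl⟩
    let g : biprodNonpos K K' ⟶ L := ObjectProperty.homMk (biprod.desc k.hom k'.hom)
    let i₁ : K ⟶ biprodNonpos K K' := ObjectProperty.homMk biprod.inl
    let i₂ : K' ⟶ biprodNonpos K K' := ObjectProperty.homMk biprod.inr
    have h₁ : i₁ ≫ g = k := by ext; exact biprod.inl_desc _ _
    have h₂ : i₂ ≫ g = k' := by ext; exact biprod.inr_desc _ _
    refine ⟨biprodNonpos K K', g, H.map i₁ u + H.map i₂ u', ?_, ?_⟩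
    · change biprod.desc k.hom k'.hom ≫ f = 0
      ext <;> simp [hk, hk']
    · rw [map_add, ← map_comp_apply', ← map_comp_apply', h₁, h₂]

lemma vanishing_le_comap {L L' : w.nonpos.FullSubcategory} {X X' : C} (f : L.obj ⟶ X)
    (f' : L'.obj ⟶ X') (l : L ⟶ L') (g : X ⟶ X') (h : l.hom ≫ f' = f ≫ g) :
    vanishing H L f ≤ (vanishing H L' f').comap (H.map l).hom := by
  rintro _ ⟨K, k, u, hk, rfl⟩
  refine ⟨K, k ≫ l, u, ?_, map_comp_apply' H _ _ _⟩
  rw [ObjectProperty.FullSubcategory.comp_hom, Category.assoc, h, reassoc_of% hk, zero_comp]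

variable [H.Additive]

/-- Half exact functors on `C_{w ≤ 0}` send weak pullbacks to weak pullbacks. -/
lemma IsHalfExact.exists_of_map_eq {H : w.nonpos.FullSubcategory ⥤ AddCommGrpCat.{v}} [H.Additive]
    (hH : IsHalfExact H) {K L E : w.nonpos.FullSubcategory} (a : L ⟶ E) (b : K ⟶ E)
    (y : H.obj L) (u : H.obj K) (hyu : H.map a y = H.map b u) :
    ∃ (T : w.nonpos.FullSubcategory) (p : T ⟶ L) (q : T ⟶ K) (t : H.obj T),
      p ≫ a = q ≫ b ∧ H.map p t = y := by
  -- The weak pullback is the fibre of (a, -b), which stays in C_{w≤0}; half exactness lifts the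
  -- pair (y, u) to it.
  obtain ⟨T, f, h, hT⟩ := distinguished_cocone_triangle₁ (biprod.desc a.hom (-b.hom))
  have hT' := comp_eq_zero_of_distTriang hT
  let T' : w.nonpos.FullSubcategory :=
    ⟨T, w.nonpos_of_distTriang hT (w.nonpos_biprod L.property K.property) E.property⟩
  let f' : T' ⟶ biprodNonpos L K := ObjectProperty.homMk f
  let g' : biprodNonpos L K ⟶ E := ObjectProperty.homMk (biprod.desc a.hom (-b.hom))
  let i₁ : L ⟶ biprodNonpos L K := ObjectProperty.homMk biprod.inl
  let i₂ : K ⟶ biprodNonpos L K := ObjectProperty.homMk biprod.inr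
  let p₁ : biprodNonpos L K ⟶ L := ObjectProperty.homMk biprod.fst
  let p₂ : biprodNonpos L K ⟶ K := ObjectProperty.homMk biprod.snd
  have h₁ : i₁ ≫ g' = a := by ext; exact biprod.inl_desc _ _
  have h₂ : i₂ ≫ g' = 0 - b := by rw [zero_sub]; ext; exact biprod.inr_desc _ _
  have h₃ : i₁ ≫ p₁ = 𝟙 L := by ext; exact biprod.inl_fst
  have h₄ : i₂ ≫ p₁ = 0 := by ext; exact biprod.inr_fst
  obtain ⟨t, ht⟩ := hH f' g' h hT (H.map i₁ y + H.map i₂ u) (by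
    rw [map_add, ← map_comp_apply', ← map_comp_apply', h₁, h₂, map_sub_apply', map_zero_apply',
      hyu]
    abel)
  refine ⟨T', f' ≫ p₁, f' ≫ p₂, t, ?_, ?_⟩
  · ext
    have : biprod.desc a.hom (-b.hom) = biprod.fst ≫ a.hom - biprod.snd ≫ b.hom := by
      ext <;> simp
    rw [this, Preadditive.comp_sub, sub_eq_zero] at hT'
    change (f ≫ biprod.fst) ≫ a.hom = (f ≫ biprod.snd) ≫ b.hom
    simpa using hT'
  · rw [map_comp_apply', ht, map_add, ← map_comp_apply', ← map_comp_apply', h₃, h₄,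
      map_id_apply', map_zero_apply', add_zero]

/-- The values of the left Kan extension of `H` to `C`. -/
noncomputable abbrev leftExtObj (X : C) : AddCommGrpCat.{v} :=
  AddCommGrpCat.of (H.obj (w.truncLE X) ⧸ vanishing H (w.truncLE X) (w.truncLEι X))

/-- The class of a pair consisting of a morphism `f : L ⟶ X` and an element of `H(L)` in the left
Kan extension of `H`. -/
noncomputable def leftExtMk {L : w.nonpos.FullSubcategory} {X : C} (f : L.obj ⟶ X) :
    H.obj L →+ leftExtObj H X :=
  (QuotientAddGroup.mk' (vanishing H (w.truncLE X) (w.truncLEι X))).comp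
    (H.map (w.exists_lift_truncLEι f).choose).hom

/-- Two lifts of f differ by a morphism that vanishes in X, so the class does not depend on the
chosen lift. -/
lemma leftExtMk_eq_mk {L : w.nonpos.FullSubcategory} {X : C} (f : L.obj ⟶ X)
    (l : L ⟶ w.truncLE X) (hl : l.hom ≫ w.truncLEι X = f) (y : H.obj L) :
    leftExtMk H f y = QuotientAddGroup.mk (H.map l y) := by
  refine QuotientAddGroup.eq_iff_sub_mem.2 ⟨L, (w.exists_lift_truncLEι f).choose - l, y, ?_,
    map_sub_apply' H _ _ _⟩
  change ((w.exists_lift_truncLEι f).choose.hom - l.hom) ≫ w.truncLEι X = 0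
  rw [Preadditive.sub_comp, hl, (w.exists_lift_truncLEι f).choose_spec, sub_self]

lemma leftExtMk_truncLEι (X : C) (y : H.obj (w.truncLE X)) :
    leftExtMk H (w.truncLEι X) y = QuotientAddGroup.mk y := by
  rw [leftExtMk_eq_mk H _ (𝟙 _) (by simp), map_id_apply']

lemma exists_leftExtMk_eq {X : C} (x : leftExtObj H X) :
    ∃ (L : w.nonpos.FullSubcategory) (f : L.obj ⟶ X) (y : H.obj L), leftExtMk H f y = x := by
  obtain ⟨y, rfl⟩ := QuotientAddGroup.mk_surjective x
  exact ⟨_, _, y, leftExtMk_truncLEι H X y⟩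

lemma leftExtMk_map {K L : w.nonpos.FullSubcategory} {X : C} (k : K ⟶ L) (f : L.obj ⟶ X)
    (u : H.obj K) : leftExtMk H f (H.map k u) = leftExtMk H (k.hom ≫ f) u := by
  obtain ⟨l, hl⟩ := w.exists_lift_truncLEι f
  rw [leftExtMk_eq_mk H f l hl, leftExtMk_eq_mk H (k.hom ≫ f) (k ≫ l) (by simp [hl]),
    map_comp_apply']

lemma leftExtMk_eq_zero {L : w.nonpos.FullSubcategory} {X : C} (f : L.obj ⟶ X) (y : H.obj L)
    (hy : y ∈ vanishing H L f) : leftExtMk H f y = 0 := by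
  obtain ⟨l, hl⟩ := w.exists_lift_truncLEι f
  rw [leftExtMk_eq_mk H f l hl]
  exact (QuotientAddGroup.eq_zero_iff _).2
    (vanishing_le_comap H f _ l (𝟙 X) (by simp [hl]) hy)

/-- By definition, vanishing is witnessed over `truncLE X`; a weak pullback along the lift L ⟶
`truncLE X` moves the witness to L. Exactness and compatibility with products both rest on this. -/
lemma mem_vanishing_of_leftExtMk_eq_zero {H : w.nonpos.FullSubcategory ⥤ AddCommGrpCat.{v}}
    [H.Additive] (hH : IsHalfExact H) {L : w.nonpos.FullSubcategory} {X : C} (f : L.obj ⟶ X)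
    (y : H.obj L) (hy : leftExtMk H f y = 0) : y ∈ vanishing H L f := by
  obtain ⟨l, hl⟩ := w.exists_lift_truncLEι f
  rw [leftExtMk_eq_mk H f l hl] at hy
  obtain ⟨K, k, u, hk, hu⟩ := (QuotientAddGroup.eq_zero_iff _).1 hy
  obtain ⟨T, p, q, t, hpq, ht⟩ := hH.exists_of_map_eq l k y u hu.symm
  refine ⟨T, p, t, ?_, ht⟩
  have := congr_arg (fun φ ↦ φ.hom ≫ w.truncLEι X) hpq
  simpa [hl, hk] using this

/-- The map induced by `g : X ⟶ X'` between the values of the left Kan extension of `H`. -/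
noncomputable def leftExtMap {X X' : C} (g : X ⟶ X') : leftExtObj H X →+ leftExtObj H X' :=
  QuotientAddGroup.lift _ (leftExtMk H (w.truncLEι X ≫ g))
    fun y hy ↦ leftExtMk_eq_zero H _ _ (by
      have := vanishing_le_comap H (w.truncLEι X) (w.truncLEι X ≫ g) (𝟙 _) g (by simp) hy
      rwa [AddSubgroup.mem_comap, show (H.map (𝟙 _)).hom y = y from map_id_apply' H y] at this)

lemma leftExtMap_leftExtMk {L : w.nonpos.FullSubcategory} {X X' : C} (f : L.obj ⟶ X)
    (g : X ⟶ X') (y : H.obj L) : leftExtMap H g (leftExtMk H f y) = leftExtMk H (f ≫ g) y := by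
  obtain ⟨l, hl⟩ := w.exists_lift_truncLEι f
  rw [leftExtMk_eq_mk H f l hl]
  refine (leftExtMk_map H l (w.truncLEι X ≫ g) y).trans ?_
  rw [← Category.assoc, hl]

/-- The left Kan extension to `C` of a functor defined on `C_{w ≤ 0}`. -/
noncomputable def leftExt : C ⥤ AddCommGrpCat.{v} where
  obj := leftExtObj H
  map g := AddCommGrpCat.ofHom (leftExtMap H g)
  map_id X := by
    refine AddCommGrpCat.ext fun x ↦ ?_
    obtain ⟨L, f, y, rfl⟩ := exists_leftExtMk_eq H x
    exact (leftExtMap_leftExtMk H f (𝟙 X) y).trans (by rw [Category.comp_id]; rfl)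
  map_comp g g' := by
    refine AddCommGrpCat.ext fun x ↦ ?_
    obtain ⟨L, f, y, rfl⟩ := exists_leftExtMk_eq H x
    refine (leftExtMap_leftExtMk H f _ y).trans ?_
    change _ = leftExtMap H g' (leftExtMap H g (leftExtMk H f y))
    rw [leftExtMap_leftExtMk, leftExtMap_leftExtMk, Category.assoc]

lemma leftExt_map_mk {L : w.nonpos.FullSubcategory} {X X' : C} (f : L.obj ⟶ X)
    (g : X ⟶ X') (y : H.obj L) : (leftExt H).map g (leftExtMk H f y) = leftExtMk H (f ≫ g) y :=
  leftExtMap_leftExtMk H f g y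

lemma leftExtMk_zero (L : w.nonpos.FullSubcategory) (X : C) (y : H.obj L) :
    leftExtMk H (0 : L.obj ⟶ X) y = 0 :=
  leftExtMk_eq_zero H _ _ ⟨L, 𝟙 L, y, by simp, map_id_apply' H y⟩

instance : (leftExt H).PreservesZeroMorphisms where
  map_zero X Y := by
    refine AddCommGrpCat.ext fun x ↦ ?_
    obtain ⟨L, f, y, rfl⟩ := exists_leftExtMk_eq H x
    refine (leftExt_map_mk H f 0 y).trans ?_
    rw [comp_zero, leftExtMk_zero]
    rfl

variable {H}

/-- A class that dies in the third term can be represented on some K whose morphism to the third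
term is zero; its morphism to the second term then lifts to the first. -/
lemma IsHalfExact.isHomological_leftExt (hH : IsHalfExact H) : (leftExt H).IsHomological where
  exact T hT := by
    rw [ShortComplex.ab_exact_iff]
    intro x hx
    obtain ⟨L, f, y, rfl⟩ := exists_leftExtMk_eq H (X := T.obj₂) x
    obtain ⟨K, k, u, hk, rfl⟩ := mem_vanishing_of_leftExtMk_eq_zero hH (f ≫ T.mor₂) y
      ((leftExt_map_mk H f _ y).symm.trans hx)
    obtain ⟨a, ha⟩ := exists_lift_of_distTriang (f := T.mor₁) hT (k.hom ≫ f)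
      ((Category.assoc _ _ _).trans hk)
    refine ⟨leftExtMk H a u, (leftExt_map_mk H a T.mor₁ u).trans ?_⟩
    rw [leftExtMk_map, ha]

lemma RespectsProducts.preservesLimits_leftExt [HasProducts.{v} C] (hH : IsHalfExact H)
    (hH' : RespectsProducts H) (I : Type v) :
    PreservesLimitsOfShape (Discrete I) (leftExt H) := by
  refine preservesLimitsOfShape_of_existsUnique _ fun X x ↦ existsUnique_of_exists_of_unique ?_ ?_
  · choose L f y hy using fun i ↦ exists_leftExtMk_eq H (x i)
    obtain ⟨E, π, -, hE⟩ := hH' L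
    obtain ⟨z, hz, -⟩ := hE y
    refine ⟨leftExtMk H (Pi.lift fun i ↦ (π i).hom ≫ f i) z, fun i ↦ ?_⟩
    rw [leftExt_map_mk, limit.lift_π]
    exact (leftExtMk_map H _ _ _).symm.trans (by rw [hz i, hy i])
  · intro x₁ x₂ h₁ h₂
    rw [← sub_eq_zero]
    have hx (i : I) : (leftExt H).map (Pi.π X i) (x₁ - x₂) = 0 := by
      rw [map_sub, h₁, h₂, sub_self]
    generalize x₁ - x₂ = x₀ at hx
    obtain ⟨L, f, y, rfl⟩ := exists_leftExtMk_eq H x₀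
    choose K k u hk hu using fun i ↦ mem_vanishing_of_leftExtMk_eq_zero hH (f ≫ Pi.π X i) y
      ((leftExt_map_mk H f _ y).symm.trans (hx i))
    -- The witnesses K i are merged into one: the weak pullback of the diagonal of L ⟶ ∏ L along ∏ K
    -- i ⟶ ∏ L.
    obtain ⟨E, π, ⟨hlim⟩, hE⟩ := hH' fun _ : I ↦ L
    obtain ⟨P, ρ, -, hP⟩ := hH' K
    obtain ⟨u', hu', -⟩ := hP u
    let δ : L ⟶ E := ObjectProperty.homMk (Fan.IsLimit.lift hlim fun _ ↦ 𝟙 L.obj)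
    let κ : P ⟶ E := ObjectProperty.homMk (Fan.IsLimit.lift hlim fun i ↦ (ρ i ≫ k i).hom)
    have hδ (i : I) : δ ≫ π i = 𝟙 L := by
      ext
      exact Fan.IsLimit.fac hlim _ i
    have hκ (i : I) : κ ≫ π i = ρ i ≫ k i := by
      ext
      exact Fan.IsLimit.fac hlim _ i
    obtain ⟨T, p, q, t, hpq, ht⟩ := hH.exists_of_map_eq δ κ y u'
      ((hE fun _ ↦ y).unique (fun i ↦ by rw [← map_comp_apply', hδ, map_id_apply'])
        fun i ↦ by rw [← map_comp_apply', hκ, map_comp_apply', hu', hu])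
    refine leftExtMk_eq_zero H _ _ ⟨T, p, t, ?_, ht⟩
    refine Limits.Pi.hom_ext _ _ fun i ↦ ?_
    have hp : p = q ≫ ρ i ≫ k i := by
      rw [← hκ, ← reassoc_of% hpq, hδ, Category.comp_id]
    simp [hp, hk]

/-- Over L itself the identity is terminal, and a witness of vanishing has k = 0. -/
lemma IsHalfExact.bijective_leftExtMk_id (hH : IsHalfExact H) (L : w.nonpos.FullSubcategory) :
    Function.Bijective (leftExtMk H (𝟙 L.obj)) := by
  refine ⟨(injective_iff_map_eq_zero _).2 fun y hy ↦ ?_, fun x ↦ ?_⟩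
  · obtain ⟨K, k, u, hk, rfl⟩ := mem_vanishing_of_leftExtMk_eq_zero hH _ y hy
    obtain rfl : k = 0 := by
      ext
      simpa using hk
    exact map_zero_apply' H u
  · obtain ⟨K, f, y, rfl⟩ := exists_leftExtMk_eq H x
    refine ⟨H.map (ObjectProperty.homMk f) y, ?_⟩
    rw [leftExtMk_map, Category.comp_id]
    rfl

/-- The left Kan extension restricts to the original functor. -/
noncomputable def IsHalfExact.leftExtIso (hH : IsHalfExact H) : w.nonpos.ι ⋙ leftExt H ≅ H :=
  let e (L : w.nonpos.FullSubcategory) : H.obj L ≃+ leftExtObj H L.obj :=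
    AddEquiv.ofBijective (leftExtMk H (𝟙 L.obj)) (hH.bijective_leftExtMk_id L)
  (NatIso.ofComponents (fun L ↦ (e L).toAddCommGrpIso) fun {L L'} f ↦
    AddCommGrpCat.ext fun y ↦ by
      refine (leftExtMk_map H f (𝟙 L'.obj) y).trans
        ((leftExt_map_mk H (𝟙 L.obj) f.hom y).trans ?_).symm
      rw [Category.comp_id, Category.id_comp]).symm

/-- A half exact functor on `C_{w ≤ 0}` that respects products is corepresented by an object of
`C_{w ≤ 0}`, if `C` satisfies dual Brown representability. -/
theorem exists_corepresenting_object (hC : DualBrownRepresentability C) (hH : IsHalfExact H)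
    (hH' : RespectsProducts H) :
    ∃ B : C, w.nonpos B ∧
      Nonempty (w.nonpos.ι ⋙ preadditiveCoyoneda.obj (Opposite.op B) ≅ H) := by
  have := hC.1
  obtain ⟨B, ⟨e⟩⟩ := hC.2 (leftExt H) hH.isHomological_leftExt (hH'.preservesLimits_leftExt hH)
  refine ⟨B, ?_, ⟨Functor.isoWhiskerLeft _ e ≪≫ hH.leftExtIso⟩⟩
  -- The extension vanishes on C_{w≥1}, since every L ⟶ Y is zero there; so B is left orthogonal to
  -- C_{w≥1}.
  rw [nonpos_eq_leftOrthogonal]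
  intro Y f hY
  have hz (x : leftExtObj H Y) : x = 0 := by
    obtain ⟨L, g, y, rfl⟩ := exists_leftExtMk_eq H x
    rw [w.orthogonal g L.property hY, leftExtMk_zero]
  apply ((e.app Y).addCommGroupIsoToAddEquiv).injective
  exact (hz _).trans (hz _).symm

end LeftExtension

end WeightStructure

end WeightT

namespace WeightT

/-! ### Coproducts, reflections to C_{w≤0} and the right adjacent t-structure. -/

variable {C : Type u} [Category.{v} C] [Preadditive C] [HasZeroObject C] [HasShift C ℤ]
  [∀ n : ℤ, (shiftFunctor C n).Additive] [Pretriangulated C]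

lemma pi_lift_π {D : Type u'} [Category.{v'} D] {I : Type v} {X : I → D} [HasProduct X] {P : D}
    (f : ∀ i, P ⟶ X i) (i : I) : Pi.lift f ≫ Pi.π X i = f i :=
  limit.lift_π _ _

/-- The functor that sends `Y` to the product of the groups `C(X i, Y)`. -/
def piCoyoneda {C : Type u} [Category.{v} C] [Preadditive C] {I : Type v} (X : I → C) : C ⥤ AddCommGrpCat.{v} where
  obj Y := AddCommGrpCat.of (∀ i, X i ⟶ Y)
  map g := AddCommGrpCat.ofHom
    { toFun := fun f i ↦ f i ≫ g
      map_zero' := funext fun i ↦ zero_comp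
      map_add' := fun f f' ↦ funext fun i ↦ Preadditive.add_comp _ _ _ _ _ _ }

instance {I : Type v} (X : I → C) : (piCoyoneda X).PreservesZeroMorphisms where
  map_zero _ _ := AddCommGrpCat.ext fun _ ↦ funext fun _ ↦ comp_zero

instance {I : Type v} (X : I → C) : (piCoyoneda X).IsHomological where
  exact T hT := by
    rw [ShortComplex.ab_exact_iff]
    intro (f : ∀ i, X i ⟶ T.obj₂) hf
    choose g hg using fun i ↦ exists_lift_of_distTriang (f := T.mor₁) hT (f i) (congr_fun hf i)
    exact ⟨g, funext hg⟩

lemma preservesLimitsOfShape_piCoyoneda {C : Type u} [Category.{v} C] [Preadditive C]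
    [HasProducts.{v} C] {I : Type v} (X : I → C)
    (J : Type v) : PreservesLimitsOfShape (Discrete J) (piCoyoneda X) := by
  refine preservesLimitsOfShape_of_existsUnique _ fun Y f ↦
    ⟨fun i ↦ Pi.lift fun j ↦ f j i, fun j ↦ funext fun i ↦ pi_lift_π _ _, ?_⟩
  exact fun g hg ↦ funext fun i ↦ Limits.Pi.hom_ext _ _ fun j ↦
    (congr_fun (hg j) i).trans (pi_lift_π (fun j ↦ f j i) j).symm

/-- Evaluating a natural isomorphism out of a corepresentable functor. -/
lemma preadditiveCoyoneda_natTrans_app {D : Type u'} [Category.{v'} D] [Preadditive D]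
    {B Y : D} {F : D ⥤ AddCommGrpCat.{v'}} (e : preadditiveCoyoneda.obj (Opposite.op B) ⟶ F)
    (g : B ⟶ Y) : e.app Y g = F.map g (e.app B (𝟙 B)) := by
  refine Eq.trans ?_ (ConcreteCategory.congr_hom (e.naturality g) (𝟙 B))
  exact congr_arg (e.app Y) (Category.id_comp g).symm

lemma bijective_of_iso_app {D : Type u'} [Category.{v'} D] {F G : D ⥤ AddCommGrpCat.{v}}
    (e : F ≅ G) {Y : D} {φ : F.obj Y → G.obj Y} (h : ∀ x, e.hom.app Y x = φ x) :
    Function.Bijective φ := by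
  obtain rfl : ⇑(e.hom.app Y).hom = φ := funext h
  exact ((e.app Y).addCommGroupIsoToAddEquiv).bijective

/-- Replacing the middle term of a distinguished triangle by an isomorphic object. -/
lemma distTriang_of_iso₂ {X Y Y' Z : C} {f : X ⟶ Y} {g : Y ⟶ Z} {h : Z ⟶ X⟦(1 : ℤ)⟧}
    (hT : Triangle.mk f g h ∈ distTriang C) (e : Y ≅ Y') :
    Triangle.mk (f ≫ e.hom) (e.inv ≫ g) h ∈ distTriang C :=
  isomorphic_distinguished _ hT _
    (Triangle.isoMk _ _ (Iso.refl _) e.symm (Iso.refl _)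
      ((show (f ≫ e.hom) ≫ e.inv = f by simp).trans (Category.id_comp f).symm)
      (Category.comp_id (e.inv ≫ g))
      ((congr_arg (h ≫ ·) ((shiftFunctor C (1 : ℤ)).map_id X)).trans
        ((Category.comp_id h).trans (Category.id_comp h).symm)))

lemma leftOrthogonal_shift {D : Type u'} [Category.{v'} D] [Preadditive D] [HasShift D ℤ]
    [∀ n : ℤ, (shiftFunctor D n).Additive] {P : ObjectProperty D} [P.IsClosedUnderIsomorphisms]
    {X : D} {a n n' : ℤ}
    (h : a + n' = n) (hX : (P.shift n).leftOrthogonal X) :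
    (P.shift n').leftOrthogonal (X⟦a⟧) := by
  intro Y f hY
  apply (shiftFunctor D (-a)).map_injective
  rw [Functor.map_zero]
  refine (cancel_epi ((shiftEquiv D a).unitIso.hom.app X)).1 ((hX _ ?_).trans comp_zero.symm)
  change (P.shift n).shift (-a) Y
  rwa [P.shift_shift (-a) n n' (by lia)]

/-- Dual Brown representability implies the existence of coproducts. -/
lemma DualBrownRepresentability.hasCoproducts (hC : DualBrownRepresentability C) :
    HasCoproducts.{v} C := by
  have := hC.1
  suffices ∀ {I : Type v} (X : I → C), HasCoproduct X from fun I ↦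
    ⟨fun F ↦ hasColimit_of_iso (Discrete.natIsoFunctor (F := F))⟩
  intro I X
  -- An object corepresenting Y ↦ ∏ C(X i, Y) is a coproduct; the inclusions are the image of its
  -- identity.
  obtain ⟨B, ⟨e⟩⟩ := hC.2 (piCoyoneda X) inferInstance (preservesLimitsOfShape_piCoyoneda X)
  let ι : ∀ i, X i ⟶ B := e.hom.app B (𝟙 B)
  have he (Y : C) (g : B ⟶ Y) : e.hom.app Y g = fun i ↦ ι i ≫ g :=
    preadditiveCoyoneda_natTrans_app e.hom g
  have hb (Y : C) : Function.Bijective fun (g : B ⟶ Y) (i : I) ↦ ι i ≫ g :=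
    bijective_of_iso_app e (he Y)
  choose d hd using fun (s : Cofan X) ↦ (hb s.pt).2 s.inj
  exact ⟨⟨Cofan.mk B ι, Cofan.IsColimit.mk _ d (fun s i ↦ congr_fun (hd s) i) fun s m hm ↦
    (hb s.pt).1 ((funext hm).trans (hd s).symm)⟩⟩

namespace WeightStructure

variable {w : WeightStructure C}

/-- Objects admit reflections to `C_{w ≤ 0}`. -/
lemma exists_reflection (hw : w.IsCosmashing) (hC : DualBrownRepresentability C) (M : C) :
    ∃ (B : C) (m : M ⟶ B), w.nonpos B ∧
      ∀ X, w.nonpos X → Function.Bijective fun g : B ⟶ X ↦ m ≫ g := by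
  let H : w.nonpos.FullSubcategory ⥤ AddCommGrpCat.{v} :=
    w.nonpos.ι ⋙ preadditiveCoyoneda.obj (Opposite.op M)
  have := hw.1
  have hH : IsHalfExact H := fun X Y Z f g h hT y hy ↦ exists_lift_of_distTriang hT y hy
  have hH' : RespectsProducts H := by
    intro I L
    have := hw.2 I
    refine ⟨⟨∏ᶜ fun i ↦ (L i).obj, w.nonpos.prop_pi _ fun i ↦ (L i).property⟩,
      fun i ↦ ObjectProperty.homMk (Pi.π _ i), ⟨productIsProduct _⟩, fun y ↦
        ⟨Pi.lift y, fun i ↦ pi_lift_π _ _, fun z hz ↦ ?_⟩⟩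
    exact Limits.Pi.hom_ext (f := fun i ↦ (L i).obj) _ _ fun i ↦
      (hz i).trans (pi_lift_π (X := fun i ↦ (L i).obj) _ _).symm
  obtain ⟨B, hB, ⟨e⟩⟩ := exists_corepresenting_object hC hH hH'
  let m : M ⟶ B := e.hom.app ⟨B, hB⟩ (𝟙 B)
  refine ⟨B, m, hB, fun X hX ↦ bijective_of_iso_app e (Y := ⟨X, hX⟩) fun (g : B ⟶ X) ↦ Eq.symm ?_⟩
  refine (ConcreteCategory.congr_hom
    (e.hom.naturality (X := ⟨B, hB⟩) (Y := ⟨X, hX⟩) (ObjectProperty.homMk g)) (𝟙 B)).symm.trans ?_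
  exact congr_arg (e.hom.app ⟨X, hX⟩) (Category.id_comp g)

/-- The triangles `A ⟶ M ⟶ B ⟶ A⟦1⟧` with `B` in `C_{w ≤ 0}` and `A` left orthogonal to
`C_{w ≤ 0}`. -/
lemma exists_reflection_triangle (hw : w.IsCosmashing) (hC : DualBrownRepresentability C)
    (M : C) : ∃ (A B : C) (f : A ⟶ M) (m : M ⟶ B) (h : B ⟶ A⟦(1 : ℤ)⟧),
      Triangle.mk f m h ∈ distTriang C ∧ w.nonpos.leftOrthogonal A ∧ w.nonpos B := by
  obtain ⟨B, m, hB, hm⟩ := exists_reflection hw hC M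
  obtain ⟨A, f, h, hT⟩ := distinguished_cocone_triangle₁ m
  refine ⟨A, B, f, m, h, hT, fun X φ hX ↦ ?_, hB⟩
  -- This composite classifies an extension E of B by X, and E lies in C_{w≤0}. As m lifts to E, the
  -- universal property of m splits E ⟶ B, so the class is zero.
  have hβ : h ≫ φ⟦(1 : ℤ)⟧' = 0 := by
    obtain ⟨E, i, q, hE⟩ := distinguished_cocone_triangle₂ (h ≫ φ⟦(1 : ℤ)⟧')
    have hE' : w.nonpos E := w.nonpos.ext_of_isTriangulatedClosed₂ _ hE hX hB
    have hmh : m ≫ h = 0 := comp_distTriang_mor_zero₂₃ _ hT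
    have hqh : q ≫ h ≫ φ⟦(1 : ℤ)⟧' = 0 := comp_distTriang_mor_zero₂₃ _ hE
    obtain ⟨s, hs⟩ : ∃ s : M ⟶ E, m = s ≫ q :=
      Triangle.coyoneda_exact₃ _ hE m (by
        change (m ≫ h ≫ φ⟦(1 : ℤ)⟧' : M ⟶ X⟦(1 : ℤ)⟧) = 0
        rw [reassoc_of% hmh, zero_comp])
    obtain ⟨t, ht⟩ := (hm E hE').2 s
    have htq : t ≫ q = 𝟙 B := (hm B hB).1 (by
      dsimp at ht ⊢
      rw [reassoc_of% ht, ← hs, Category.comp_id])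
    rw [← Category.id_comp h, ← htq, Category.assoc, Category.assoc, hqh, comp_zero]
  -- Hence φ factors through f up to sign; the second factor M ⟶ X factors through m, and f ≫ m = 0.
  obtain ⟨ψ, hψ⟩ : ∃ ψ : M⟦(1 : ℤ)⟧ ⟶ X⟦(1 : ℤ)⟧, φ⟦(1 : ℤ)⟧' = (-f⟦(1 : ℤ)⟧') ≫ ψ :=
    Triangle.yoneda_exact₃ _ (rot_of_distTriang _ hT) _ hβ
  obtain ⟨ψ, rfl⟩ := (shiftFunctor C (1 : ℤ)).map_surjective ψ
  obtain ⟨g, rfl⟩ := (hm X hX).2 ψ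
  apply (shiftFunctor C (1 : ℤ)).map_injective
  have hfm : f ≫ m = 0 := comp_eq_zero_of_distTriang hT
  rw [hψ, Preadditive.neg_comp, ← Functor.map_comp, reassoc_of% hfm, zero_comp]
  simp

/-- The `t`-structure right adjacent to a cosmashing weight structure, under dual Brown
representability. -/
def rightAdjacentTStructure (hw : w.IsCosmashing) (hC : DualBrownRepresentability C) :
    TStructure C where
  -- `w.nonpos.shift n` is C_{w≤-n}; the index n + 1 reflects t_{≥-n} = ⊥C_{w≤-n-1}.
  le n := (w.nonpos.shift (n + 1)).leftOrthogonal
  ge n := w.nonpos.shift n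
  le_shift n a n' h X hX := leftOrthogonal_shift (by lia) hX
  ge_shift n a n' h X hX := by
    rwa [← w.nonpos.shift_shift a n' n h] at hX
  zero' X Y f hX hY := hX f (by rwa [zero_add])
  le_zero_le X hX Y f hY := hX f (by
    rw [← w.nonpos.shift_shift (1 + 1) (-1) (0 + 1) (by lia)]
    exact w.nonpos_shift hY)
  ge_one_le X hX := by
    rw [← w.nonpos.shift_shift 1 (-1) 0 (by lia)]
    exact w.nonpos_shift hX
  exists_triangle_zero_one M := by
    -- The required triangle has terms in t_{≥0} and t_{≤-1}, one step below the reflection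
    -- triangle; hence the shift of M and the shift back.
    obtain ⟨A, B, f, m, h, hT, hA, hB⟩ := exists_reflection_triangle hw hC (M⟦(1 : ℤ)⟧)
    let T := (Triangle.shiftFunctor C (-1)).obj (Triangle.mk f m h)
    let e := (shiftEquiv C (1 : ℤ)).unitIso.symm.app M
    refine ⟨A⟦(-1 : ℤ)⟧, B⟦(-1 : ℤ)⟧, leftOrthogonal_shift (n := 0) (by lia) ?_,
      w.nonpos_shift_shift hB, T.mor₁ ≫ e.hom, e.inv ≫ T.mor₂, T.mor₃, ?_⟩
    · rwa [ObjectProperty.shift_zero]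
    · exact distTriang_of_iso₂ (Triangle.shift_distinguished _ hT (-1)) e

section

variable (hw : w.IsCosmashing) (hC : DualBrownRepresentability C)

lemma homLE_rightAdjacentTStructure_zero :
    homLE (rightAdjacentTStructure hw hC) 0 = w.nonpos :=
  ObjectProperty.shift_zero _ _

lemma homGE_rightAdjacentTStructure_one :
    homGE (rightAdjacentTStructure hw hC) 1 = w.nonpos.leftOrthogonal :=
  congr_arg ObjectProperty.leftOrthogonal (ObjectProperty.shift_zero _ _)

lemma antiOrthogonal_rightAdjacentTStructure :
    RightAdjacent w (rightAdjacentTStructure hw hC) := by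
  refine ⟨fun X Y f hX hY ↦ ?_, fun X Y f hX hY ↦ w.hom_eq_zero f hX hY⟩
  rw [homGE_rightAdjacentTStructure_one] at hX
  exact hX f hY

/-- Left orthogonal classes inherit coproducts, so t is smashing even if w is not. -/
lemma nonpos_isClosedUnderColimitsOfShape (w : WeightStructure C) (J : Type u') :
    w.nonpos.IsClosedUnderColimitsOfShape (Discrete J) := by
  rw [nonpos_eq_leftOrthogonal]
  exact ⟨fun X ⟨h⟩ Y f hY ↦ h.isColimit.hom_ext fun j ↦
    (h.prop_diag_obj j _ hY).trans comp_zero.symm⟩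

lemma isSmashing_rightAdjacentTStructure :
    IsSmashingTStructure (rightAdjacentTStructure hw hC) := by
  refine ⟨hC.hasCoproducts, fun I ↦ ?_⟩
  rw [homLE_rightAdjacentTStructure_zero]
  exact w.nonpos_isClosedUnderColimitsOfShape I

end

end WeightStructure

end WeightT

namespace WeightT

/-! ### Partial coproducts as idempotents, and α-small objects. -/

section Projections

variable {C : Type u} [Category.{v} C] [Preadditive C] {I : Type v} {N : I → C}

open Classical in
/-- The endomorphism of a coproduct that is the identity on the summands indexed by `J` and zero
on the other ones. -/
noncomputable def coproductProj {D : C} {ι : ∀ i, N i ⟶ D} (hD : IsColimit (Cofan.mk D ι))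
    (J : Set I) : D ⟶ D :=
  Cofan.IsColimit.desc hD fun i ↦ if i ∈ J then ι i else 0

variable {D : C} {ι : ∀ i, N i ⟶ D} (hD : IsColimit (Cofan.mk D ι)) {J : Set I}

lemma inj_comp_coproductProj_of_mem {i : I} (hi : i ∈ J) : ι i ≫ coproductProj hD J = ι i :=
  (Cofan.IsColimit.fac hD _ i).trans (if_pos hi)

lemma inj_comp_coproductProj_of_notMem {i : I} (hi : i ∉ J) : ι i ≫ coproductProj hD J = 0 :=
  (Cofan.IsColimit.fac hD _ i).trans (if_neg hi)

lemma coproductProj_comp {D' : C} {N' : I → C} {ι' : ∀ i, N' i ⟶ D'}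
    (hD' : IsColimit (Cofan.mk D' ι')) (φ : ∀ i, N i ⟶ N' i) (f : D ⟶ D')
    (h : ∀ i, ι i ≫ f = φ i ≫ ι' i) (J : Set I) :
    coproductProj hD J ≫ f = f ≫ coproductProj hD' J := by
  refine Cofan.IsColimit.hom_ext hD _ _ fun i ↦ ?_
  change ι i ≫ _ = ι i ≫ _
  rw [reassoc_of% h i]
  by_cases hi : i ∈ J
  · rw [← Category.assoc, inj_comp_coproductProj_of_mem hD hi,
      inj_comp_coproductProj_of_mem hD' hi, h]
  · rw [← Category.assoc, inj_comp_coproductProj_of_notMem hD hi,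
      inj_comp_coproductProj_of_notMem hD' hi, zero_comp, comp_zero]

lemma coproductProj_comp_coproductProj {K : Set I} (h : J ⊆ K) :
    coproductProj hD J ≫ coproductProj hD K = coproductProj hD J := by
  refine Cofan.IsColimit.hom_ext hD _ _ fun i ↦ ?_
  change ι i ≫ _ = ι i ≫ _
  by_cases hi : i ∈ J
  · rw [← Category.assoc, inj_comp_coproductProj_of_mem hD hi,
      inj_comp_coproductProj_of_mem hD (h hi)]
  · rw [← Category.assoc, inj_comp_coproductProj_of_notMem hD hi, zero_comp]

end Projections

section Factorizations

variable {C : Type u} [Category.{v} C] [Preadditive C]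

/-- The property of objects `M` such that any morphism from `M` to a coproduct factors through
less than `α` summands. -/
def factorsThroughSmall (C : Type u) [Category.{v} C] [Preadditive C] (α : Cardinal.{v}) :
    ObjectProperty C :=
  fun M ↦ ∀ ⦃I : Type v⦄ ⦃N : I → C⦄ ⦃D : C⦄ ⦃ι : ∀ i, N i ⟶ D⦄ (hD : IsColimit (Cofan.mk D ι))
    (f : M ⟶ D), ∃ J : Set I, Cardinal.mk J < α ∧ f ≫ coproductProj hD J = f

instance (α : Cardinal.{v}) : (factorsThroughSmall C α).IsClosedUnderIsomorphisms where
  of_iso e h I N D ι hD f := by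
    obtain ⟨J, hJ, hf⟩ := h hD (e.hom ≫ f)
    exact ⟨J, hJ, by simpa using hf⟩

section

variable [HasCoproducts.{v} C] {I : Type v} (N : I → C)

open Classical in
/-- The retraction of the inclusion of a partial coproduct. -/
noncomputable def partialCoproductRetraction (J : Set I) : ∐ N ⟶ ∐ fun j : J ↦ N j :=
  Sigma.desc fun i ↦ if hi : i ∈ J then Sigma.ι (fun j : J ↦ N j) ⟨i, hi⟩ else 0

/-- The inclusion of a partial coproduct. -/
noncomputable def partialCoproductInclusion (J : Set I) : (∐ fun j : J ↦ N j) ⟶ ∐ N :=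
  Sigma.map' (fun j : J ↦ (j : I)) fun j ↦ 𝟙 (N j)

lemma partialCoproductInclusion_comp_retraction (J : Set I) :
    partialCoproductInclusion N J ≫ partialCoproductRetraction N J = 𝟙 _ := by
  refine Sigma.hom_ext _ _ fun j ↦ ?_
  simp [partialCoproductInclusion, partialCoproductRetraction]

lemma partialCoproductRetraction_comp_inclusion (J : Set I) :
    partialCoproductRetraction N J ≫ partialCoproductInclusion N J =
      coproductProj (coproductIsCoproduct N) J := by
  refine Sigma.hom_ext _ _ fun i ↦ ?_
  by_cases hi : i ∈ J
  · rw [inj_comp_coproductProj_of_mem _ hi]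
    simp [partialCoproductInclusion, partialCoproductRetraction, hi]
  · rw [inj_comp_coproductProj_of_notMem _ hi]
    simp [partialCoproductInclusion, partialCoproductRetraction, hi]

lemma card_union_lt {α : Cardinal.{v}} (hα : Cardinal.aleph0 ≤ α) {J K : Set I}
    (hJ : Cardinal.mk J < α) (hK : Cardinal.mk K < α) : Cardinal.mk (J ∪ K : Set I) < α :=
  (Cardinal.mk_union_le J K).trans_lt (Cardinal.add_lt_of_lt hα hJ hK)

lemma isFiltered_smallSubsets (I : Type v) {α : Cardinal.{v}} (hα : Cardinal.aleph0 ≤ α) :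
    IsFiltered {J : Set I // Cardinal.mk J < α} := by
  have : Nonempty {J : Set I // Cardinal.mk J < α} :=
    ⟨⟨∅, by simpa using Cardinal.aleph0_pos.trans_le hα⟩⟩
  have : IsDirectedOrder {J : Set I // Cardinal.mk J < α} :=
    ⟨fun J K ↦ ⟨⟨J.1 ∪ K.1, card_union_lt hα J.2 K.2⟩, Set.subset_union_left,
      Set.subset_union_right⟩⟩
  infer_instance

end

/-- Inclusions of partial coproducts split, so injectivity of the comparison with the colimit is
automatic and only surjectivity matters. As α is infinite, the colimit is filtered and can be tested
on underlying sets. -/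
lemma smallObjects_eq_factorsThroughSmall [HasCoproducts.{v} C] {α : Cardinal.{v}}
    (hα : Cardinal.aleph0 ≤ α) : smallObjects C α = factorsThroughSmall C α := by
  ext M
  constructor
  · intro hM I N D ι hD f
    have := isFiltered_smallSubsets I hα
    obtain ⟨h⟩ := hM I N
    let e : ∐ N ≅ D := (coproductIsCoproduct N).coconePointUniqueUpToIso hD
    have he (i : I) : Sigma.ι N i ≫ e.hom = 𝟙 (N i) ≫ ι i := by
      rw [Category.id_comp]
      exact (coproductIsCoproduct N).comp_coconePointUniqueUpToIso_hom hD ⟨i⟩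
    obtain ⟨J, (g : M ⟶ ∐ fun j : J.1 ↦ N j), hg⟩ := Types.jointly_surjective_of_isColimit
      (isColimitOfPreserves (forget AddCommGrpCat.{v}) h) (show M ⟶ ∐ N from f ≫ e.inv)
    replace hg : g ≫ partialCoproductInclusion N J.1 = f ≫ e.inv := hg
    refine ⟨J.1, J.2, ?_⟩
    have hg' : f = g ≫ partialCoproductInclusion N J.1 ≫ e.hom := by
      rw [reassoc_of% hg, e.inv_hom_id, Category.comp_id]
    rw [hg', Category.assoc, Category.assoc,
      ← coproductProj_comp (coproductIsCoproduct N) hD (fun i ↦ 𝟙 (N i)) e.hom he,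
      ← partialCoproductRetraction_comp_inclusion, Category.assoc,
      reassoc_of% partialCoproductInclusion_comp_retraction N J.1]
  · intro hM I N
    have := isFiltered_smallSubsets I hα
    have : ReflectsColimitsOfShape {J : Set I // Cardinal.mk J < α} (forget AddCommGrpCat.{v}) :=
      reflectsColimitsOfShape_of_reflectsIsomorphisms
    refine ⟨isColimitOfReflects (forget AddCommGrpCat.{v})
      (Types.FilteredColimit.isColimitOf' _ _ (fun (f : M ⟶ ∐ N) ↦ ?_) ?_)⟩
    · obtain ⟨J, hJ, hf⟩ := hM (coproductIsCoproduct N) f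
      refine ⟨⟨J, hJ⟩, f ≫ partialCoproductRetraction N J, ?_⟩
      refine Eq.trans ?_ (Category.assoc f (partialCoproductRetraction N J)
        (partialCoproductInclusion N J)).symm
      rw [partialCoproductRetraction_comp_inclusion]
      exact hf.symm
    · intro J (f : M ⟶ ∐ fun j : J.1 ↦ N j) (g : M ⟶ ∐ fun j : J.1 ↦ N j) hfg
      refine ⟨J, 𝟙 J, ?_⟩
      replace hfg : f ≫ partialCoproductInclusion N J.1 =
        g ≫ partialCoproductInclusion N J.1 := hfg
      have := congr_arg (· ≫ partialCoproductRetraction N J.1) hfg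
      simp only [Category.assoc, partialCoproductInclusion_comp_retraction,
        Category.comp_id] at this
      rw [this]

end Factorizations

section Triangulated

variable {C : Type u} [Category.{v} C] [Preadditive C] [HasZeroObject C] [HasShift C ℤ]
  [∀ n : ℤ, (shiftFunctor C n).Additive] [Pretriangulated C] {α : Cardinal.{v}}

lemma factorsThroughSmall_isTriangulated (hα : Cardinal.aleph0 ≤ α) :
    (factorsThroughSmall C α).IsTriangulated where
  exists_zero := by
    obtain ⟨Z, hZ⟩ := HasZeroObject.zero (C := C)
    exact ⟨Z, hZ, fun I N D ι hD f ↦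
      ⟨∅, by simpa using Cardinal.aleph0_pos.trans_le hα, hZ.eq_of_src _ _⟩⟩
  isStableUnderShiftBy n := ⟨fun M hM I N D ι hD f ↦ by
    let S := shiftFunctor C (-n)
    let hD' := isColimitCofanMkObjOfIsColimit S _ _ hD
    obtain ⟨J, hJ, h⟩ := hM hD' ((shiftEquiv C n).unitIso.hom.app M ≫ S.map f)
    refine ⟨J, hJ, S.map_injective ?_⟩
    have hS : coproductProj hD' J = S.map (coproductProj hD J) := by
      refine Cofan.IsColimit.hom_ext hD' _ _ fun i ↦ ?_
      change S.map (ι i) ≫ _ = S.map (ι i) ≫ _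
      rw [← Functor.map_comp]
      by_cases hi : i ∈ J
      · rw [inj_comp_coproductProj_of_mem hD hi, inj_comp_coproductProj_of_mem hD' hi]
      · rw [inj_comp_coproductProj_of_notMem hD hi, inj_comp_coproductProj_of_notMem hD' hi,
          Functor.map_zero]
    rw [Functor.map_comp, ← hS]
    refine (cancel_epi ((shiftEquiv C n).unitIso.hom.app M)).1 ?_
    exact (Category.assoc _ _ _).symm.trans h⟩
  toIsTriangulatedClosed₂ := .mk' fun T hT h₁ h₃ I N D ι hD f ↦ by
    obtain ⟨J, hJ, hfJ⟩ := h₁ hD (T.mor₁ ≫ f)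
    -- After subtracting the J-part, f vanishes on the first term and descends to the third, which
    -- needs only the summands in K; so J ∪ K suffices.
    obtain ⟨g, hg⟩ := exists_desc_of_distTriang (f := T.mor₁) hT (f - f ≫ coproductProj hD J)
      (by rw [Preadditive.comp_sub, ← Category.assoc, hfJ, sub_self])
    obtain ⟨K, hK, hgK⟩ := h₃ hD g
    refine ⟨J ∪ K, card_union_lt hα hJ hK, ?_⟩
    have hf : f = f ≫ coproductProj hD J + T.mor₂ ≫ g ≫ coproductProj hD K := by
      rw [hgK, hg, add_sub_cancel]
    conv_lhs => rw [hf]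
    rw [Preadditive.add_comp, Category.assoc, Category.assoc, Category.assoc,
      coproductProj_comp_coproductProj hD Set.subset_union_left,
      coproductProj_comp_coproductProj hD Set.subset_union_right, ← hf]

end Triangulated

/-! ### Restriction of the t-structure to α-small objects. -/

section Coproducts

variable {C : Type u} [Category.{v} C] [Preadditive C] [HasZeroObject C] [HasShift C ℤ]
  [∀ n : ℤ, (shiftFunctor C n).Additive] [Pretriangulated C]

/-- The cone of a coproduct of morphisms is a retract of the coproduct of their cones. -/
lemma exists_retract_cone_coproduct {I : Type v} {X Y Z : I → C} {f : ∀ i, X i ⟶ Y i}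
    {g : ∀ i, Y i ⟶ Z i} {h : ∀ i, Z i ⟶ (X i)⟦(1 : ℤ)⟧}
    (hT : ∀ i, Triangle.mk (f i) (g i) (h i) ∈ distTriang C)
    {E D R S : C} {ι : ∀ i, X i ⟶ E} {κ : ∀ i, Y i ⟶ D} {σ : ∀ i, Z i ⟶ S}
    (hE : IsColimit (Cofan.mk E ι)) (hD : IsColimit (Cofan.mk D κ))
    (hS : IsColimit (Cofan.mk S σ)) {l : E ⟶ D} (hl : ∀ i, ι i ≫ l = f i ≫ κ i)
    {m : D ⟶ R} {n : R ⟶ E⟦(1 : ℤ)⟧} (hR : Triangle.mk l m n ∈ distTriang C) :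
    Nonempty (Retract R S) := by
  have hψ (i : I) : ∃ ψ : Z i ⟶ R, g i ≫ ψ = κ i ≫ m ∧ h i ≫ (ι i)⟦(1 : ℤ)⟧' = ψ ≫ n :=
    complete_distinguished_triangle_morphism _ _ (hT i) hR (ι i) (κ i) (hl i).symm
  choose ψ hψ hψ' using hψ
  let φ : S ⟶ R := Cofan.IsColimit.desc hS ψ
  have hφ (i : I) : σ i ≫ φ = ψ i := Cofan.IsColimit.fac hS _ i
  obtain ⟨Q, z, y, hQ⟩ := distinguished_cocone_triangle φ
  have hφz : φ ≫ z = 0 := comp_eq_zero_of_distTriang hQ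
  have hψz (i : I) : ψ i ≫ z = 0 := by rw [← hφ, Category.assoc, hφz, comp_zero]
  -- It suffices that the cone morphism z of φ vanishes, for then φ is a split epimorphism. As z
  -- kills the image of D, it factors through E⟦1⟧; componentwise, that factor extends along l⟦1⟧,
  -- and n ≫ l⟦1⟧ = 0.
  have hz : z = 0 := by
    obtain ⟨u, rfl⟩ : ∃ u : E⟦(1 : ℤ)⟧ ⟶ Q, z = n ≫ u :=
      Triangle.yoneda_exact₃ _ hR z (by
        refine Cofan.IsColimit.hom_ext hD _ _ fun i ↦ ?_
        change κ i ≫ m ≫ z = κ i ≫ 0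
        rw [← reassoc_of% hψ i, hψz, comp_zero, comp_zero])
    have hv (i : I) : ∃ v : (Y i)⟦(1 : ℤ)⟧ ⟶ Q, (ι i)⟦(1 : ℤ)⟧' ≫ u = (-(f i)⟦(1 : ℤ)⟧') ≫ v :=
      Triangle.yoneda_exact₃ _ (rot_of_distTriang _ (hT i)) _ (by
        change h i ≫ (ι i)⟦(1 : ℤ)⟧' ≫ u = 0
        rw [reassoc_of% hψ' i, hψz])
    choose v hv using hv
    let hD' := isColimitCofanMkObjOfIsColimit (shiftFunctor C (1 : ℤ)) _ _ hD
    let hE' := isColimitCofanMkObjOfIsColimit (shiftFunctor C (1 : ℤ)) _ _ hE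
    let V : D⟦(1 : ℤ)⟧ ⟶ Q := Cofan.IsColimit.desc hD' v
    have hV (i : I) : (κ i)⟦(1 : ℤ)⟧' ≫ V = v i := Cofan.IsColimit.fac hD' _ i
    have hu : u = -(l⟦(1 : ℤ)⟧' ≫ V) := by
      refine Cofan.IsColimit.hom_ext hE' _ _ fun i ↦ ?_
      change (ι i)⟦(1 : ℤ)⟧' ≫ u = (ι i)⟦(1 : ℤ)⟧' ≫ (-(l⟦(1 : ℤ)⟧' ≫ V))
      rw [hv, Preadditive.comp_neg, ← Functor.map_comp_assoc, hl, Functor.map_comp_assoc, hV,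
        Preadditive.neg_comp]
    have hnl : n ≫ l⟦(1 : ℤ)⟧' = 0 := comp_distTriang_mor_zero₃₁ _ hR
    rw [hu, Preadditive.comp_neg, reassoc_of% hnl, zero_comp, neg_zero]
  obtain ⟨s, hs⟩ := exists_lift_of_distTriang hQ (𝟙 R) (by rw [hz, comp_zero])
  exact ⟨⟨s, φ, hs⟩⟩

namespace WeightStructure

variable {w : WeightStructure C}

lemma IsSmashing.pos_of_isColimit (hw : w.IsSmashing) {I : Type v} {Z : I → C} {S : C}
    {σ : ∀ i, Z i ⟶ S} (hS : IsColimit (Cofan.mk S σ)) (hZ : ∀ i, w.pos (Z i)) : w.pos S := by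
  have := hw.2 I
  exact w.nonneg.prop_of_isColimit
    (isColimitCofanMkObjOfIsColimit (shiftFunctor C (-1 : ℤ)) _ _ hS) fun i ↦ hZ i.as

/-- If `w` is smashing, then the reflection to `C_{w ≤ 0}` respects the objects for which
morphisms to coproducts factor through less than `α` summands. -/
lemma IsSmashing.factorsThroughSmall_of_distTriang [HasCoproducts.{v} C] (hw : w.IsSmashing)
    {α : Cardinal.{v}} {A M B : C} {f : A ⟶ M} {m : M ⟶ B} {h : B ⟶ A⟦(1 : ℤ)⟧}
    (hT : Triangle.mk f m h ∈ distTriang C) (hA : w.nonpos.leftOrthogonal A)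
    (hB : w.nonpos B) (hM : factorsThroughSmall C α M) : factorsThroughSmall C α B := by
  intro I N D ι hD b
  choose L R a g k hT' hL hR using fun i ↦ w.exists_decomposition (N i)
  let hE := coproductIsCoproduct L
  let l : ∐ L ⟶ D := Sigma.desc fun i ↦ a i ≫ ι i
  have hl (i : I) : Sigma.ι L i ≫ l = a i ≫ ι i := by simp [l]
  obtain ⟨Q, q, d, hQ⟩ := distinguished_cocone_triangle l
  obtain ⟨r⟩ := exists_retract_cone_coproduct hT' hE hD (coproductIsCoproduct R) hl hQ
  have hQ' : w.pos Q := w.nonneg.prop_of_retract (r.map (shiftFunctor C (-1 : ℤ)))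
    (hw.pos_of_isColimit (coproductIsCoproduct R) hR)
  -- The cone Q of ∐ L ⟶ D lies in C_{w≥1}, so b lifts to ∐ L, to which the smallness of M applies.
  obtain ⟨b, rfl⟩ := exists_lift_of_distTriang hQ b (w.orthogonal _ hB hQ')
  obtain ⟨J, hJ, hbJ⟩ := hM hE (m ≫ b)
  refine ⟨J, hJ, ?_⟩
  -- The difference vanishes on M, so it factors through A⟦1⟧, which has no nonzero morphisms to ∐ L
  -- in C_{w≤0}.
  have hbJ' : b - b ≫ coproductProj hE J = 0 := by
    obtain ⟨c, hc⟩ : ∃ c : A⟦(1 : ℤ)⟧ ⟶ ∐ L, b - b ≫ coproductProj hE J = h ≫ c :=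
      Triangle.yoneda_exact₃ _ hT _ (by
        change m ≫ (b - b ≫ coproductProj hE J) = 0
        rw [Preadditive.comp_sub, ← Category.assoc, hbJ, sub_self])
    have hA' : (w.nonpos.shift (-1 : ℤ)).leftOrthogonal (A⟦(1 : ℤ)⟧) :=
      leftOrthogonal_shift (n := 0) (by lia) (by rwa [ObjectProperty.shift_zero])
    have := w.nonpos_isClosedUnderColimitsOfShape I
    rw [hc, hA' c (w.nonpos_shift (w.nonpos.prop_of_isColimit hE fun i ↦ hL i.as)), comp_zero]
  rw [Category.assoc, ← coproductProj_comp hE hD a l hl, ← Category.assoc,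
    ← sub_eq_zero.1 hbJ']

/-- Shifted by 1, the truncation triangle is a reflection triangle, so its third term is small; the
first follows by two out of three. -/
lemma IsSmashing.hasInducedTStructure [HasCoproducts.{v} C] (hw : w.IsSmashing)
    (hw' : w.IsCosmashing) (hC : DualBrownRepresentability C) {α : Cardinal.{v}}
    (hα : Cardinal.aleph0 ≤ α) [(smallObjects C α).IsTriangulated] :
    (smallObjects C α).HasInducedTStructure (rightAdjacentTStructure hw' hC) where
  exists_triangle_zero_one M hM := by
    obtain ⟨X, Y, hX, hY, f, g, h, hT⟩ :=
      (rightAdjacentTStructure hw' hC).exists_triangle_zero_one M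
    have : (smallObjects C α).IsClosedUnderIsomorphisms := by
      rw [smallObjects_eq_factorsThroughSmall hα]
      infer_instance
    have hX' : w.nonpos.leftOrthogonal (X⟦(1 : ℤ)⟧) := by
      have : (w.nonpos.shift (0 : ℤ)).leftOrthogonal (X⟦(1 : ℤ)⟧) :=
        leftOrthogonal_shift (n := 0 + 1) (by lia) hX
      rwa [ObjectProperty.shift_zero] at this
    have hY' : smallObjects C α (Y⟦(1 : ℤ)⟧) := by
      have hM' := (smallObjects C α).le_shift (1 : ℤ) M hM
      rw [ObjectProperty.prop_shift_iff] at hM'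
      rw [smallObjects_eq_factorsThroughSmall hα] at hM' ⊢
      exact hw.factorsThroughSmall_of_distTriang (Triangle.shift_distinguished _ hT 1) hX' hY hM'
    replace hY' := ((smallObjects C α).prop_shift_iff_of_isStableUnderShift Y (1 : ℤ)).1 hY'
    exact ⟨X, Y, ⟨hX⟩, ⟨hY⟩, f, g, h, hT,
      (smallObjects C α).ext_of_isTriangulatedClosed₁' _ hT hM hY',
      (smallObjects C α).le_isoClosure _ hY'⟩

end WeightStructure

end Coproducts

/-! ### Uniqueness of the anti-orthogonal t-structure. -/

section Uniqueness

variable {C : Type u} [Category.{v} C] [Preadditive C] [HasZeroObject C] [HasShift C ℤ]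
  [∀ n : ℤ, (shiftFunctor C n).Additive] [Pretriangulated C]

lemma tStructure_le_of_le {t t' : TStructure C} (h : ∀ n, t'.ge n ≤ t.ge n) (n : ℤ) :
    t.le n ≤ t'.le n := by
  intro X hX
  rw [TStructure.le_iff_isLE] at hX ⊢
  rw [t'.isLE_iff_orthogonal n (n + 1) rfl]
  exact fun Y f hY ↦ t.zero_of_isLE_of_isGE f n (n + 1) (by lia) hX ⟨h _ _ hY.ge⟩

lemma tStructure_ge_of_ge {t t' : TStructure C} (h : ∀ n, t'.le n ≤ t.le n) (n : ℤ) :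
    t.ge n ≤ t'.ge n := by
  intro X hX
  rw [TStructure.ge_iff_isGE] at hX ⊢
  rw [t'.isGE_iff_orthogonal (n - 1) n (by lia)]
  exact fun Y f hY ↦ t.zero_of_isLE_of_isGE f (n - 1) n (by lia) ⟨h _ _ hY.le⟩ hX

/-- Each half of a t-structure is the orthogonal of the other, so an inclusion of one half reverses
on the other. -/
lemma tStructure_eq {t t' : TStructure C} (h₁ : homGE t' 1 ≤ homGE t 1)
    (h₂ : homLE t' (-1) ≤ homLE t (-1)) : t' = t := by
  have hle (n : ℤ) : t'.le n ≤ t.le n := by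
    rw [← t'.shift_le (n + 1) (-1) n (by lia), ← t.shift_le (n + 1) (-1) n (by lia)]
    exact fun X hX ↦ h₁ _ hX
  have hge (n : ℤ) : t'.ge n ≤ t.ge n := by
    rw [← t'.shift_ge (n - 1) (- -1) n (by lia), ← t.shift_ge (n - 1) (- -1) n (by lia)]
    exact fun X hX ↦ h₂ _ hX
  have hle' : t'.le = t.le := funext fun n ↦ le_antisymm (hle n) (tStructure_le_of_le hge n)
  have hge' : t'.ge = t.ge := funext fun n ↦ le_antisymm (hge n) (tStructure_ge_of_ge hle n)
  cases t
  cases t'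
  subst hle' hge'
  rfl

/-- The two conditions on t' place its halves in ⊥C_{w≤0} = t_{≥1} and in ⊥C_{w≥0} = C_{w≤-1} =
t_{≤-1}. -/
lemma WeightStructure.eq_of_antiOrthogonal {w : WeightStructure C} (hw : w.IsCosmashing)
    (hC : DualBrownRepresentability C) (P : ObjectProperty C) [P.IsTriangulated]
    [P.HasInducedTStructure (rightAdjacentTStructure hw hC)] (t' : TStructure P.FullSubcategory)
    (ht' : AntiOrthogonal P.ι w t') : t' = P.tStructure (rightAdjacentTStructure hw hC) := by
  refine tStructure_eq (fun X hX ↦ ?_) fun X hX ↦ ?_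
  · change homGE (rightAdjacentTStructure hw hC) 1 X.obj
    rw [homGE_rightAdjacentTStructure_one]
    exact fun Y f hY ↦ ht'.1 X Y f hX hY
  · change w.nonpos (X.obj⟦(1 : ℤ)⟧)
    rw [w.nonpos_eq_leftOrthogonal]
    refine leftOrthogonal_shift (n := 0) (by lia) ?_
    rw [ObjectProperty.shift_zero]
    exact fun Y f hY ↦ ht'.2 X Y f hX hY

end Uniqueness

end WeightT

namespace WeightT

/-! ### Products in the heart of w and weak reflections to it. -/

namespace WeightStructure

variable {C : Type u} [Category.{v} C] [Preadditive C] [HasZeroObject C] [HasShift C ℤ]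
  [∀ n : ℤ, (shiftFunctor C n).Additive] [Pretriangulated C] {w : WeightStructure C}

lemma nonneg_eq_rightOrthogonal (w : WeightStructure C) :
    w.nonneg = (w.nonpos.shift (1 : ℤ)).rightOrthogonal := by
  ext Q
  refine ⟨fun hQ X f hX ↦ w.hom_eq_zero f hX hQ, fun hQ ↦ (w.pos_shift_iff Q).1 ?_⟩
  rw [pos_eq_rightOrthogonal]
  intro X f hX
  apply (shiftFunctor C (-1 : ℤ)).map_injective
  rw [Functor.map_zero]
  exact (cancel_mono ((shiftEquiv C (1 : ℤ)).unitIso.inv.app Q)).1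
    ((hQ _ (w.nonpos_shift_shift hX)).trans zero_comp.symm)

lemma nonneg_isClosedUnderLimitsOfShape (w : WeightStructure C) (J : Type u') :
    w.nonneg.IsClosedUnderLimitsOfShape (Discrete J) := by
  rw [nonneg_eq_rightOrthogonal]
  exact ⟨fun X ⟨h⟩ Y f hY ↦ h.isLimit.hom_ext fun j ↦
    (h.prop_diag_obj j _ hY).trans zero_comp.symm⟩

lemma IsCosmashing.heart_isClosedUnderLimitsOfShape (hw : w.IsCosmashing) (I : Type v) :
    w.heart.IsClosedUnderLimitsOfShape (Discrete I) := by
  have := hw.2 I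
  have := w.nonneg_isClosedUnderLimitsOfShape I
  exact ⟨fun X ⟨h⟩ ↦ ⟨w.nonpos.prop_of_isLimit h.isLimit fun j ↦ (h.prop_diag_obj j).1,
    w.nonneg.prop_of_isLimit h.isLimit fun j ↦ (h.prop_diag_obj j).2⟩⟩

/-- The obstruction lies in C(W⟦-1⟧, Q'), which is zero by orthogonality. So Y ⟶ Q with Q in the
heart is a weak reflection to the heart. -/
lemma exists_factor_of_distTriang {Y Q W Q' : C} {p : Y ⟶ Q} {j : Q ⟶ W} {d : W ⟶ Y⟦(1 : ℤ)⟧}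
    (hT : Triangle.mk p j d ∈ distTriang C) (hW : w.nonpos W) (hQ' : w.nonneg Q') (q : Y ⟶ Q') :
    ∃ g : Q ⟶ Q', p ≫ g = q :=
  exists_extension_of_distTriang hT q fun b ↦ w.hom_eq_zero b (w.nonpos_shift_shift hW) hQ'

section HeartApproximation

/-- The object of the heart in a chosen distinguished triangle `Y ⟶ Q ⟶ W ⟶ Y⟦1⟧`. -/
noncomputable def heartApprox (Y : w.nonpos.FullSubcategory) : w.heart.FullSubcategory :=
  ⟨(w.exists_heart_triangle Y.property).choose,
    (w.exists_heart_triangle Y.property).choose_spec.choose_spec.choose_spec.choose_spec.choose_spec.2.1⟩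

/-- The object `W` of `C_{w ≤ 0}` in a chosen distinguished triangle `Y ⟶ Q ⟶ W ⟶ Y⟦1⟧`. -/
noncomputable def heartCone (Y : w.nonpos.FullSubcategory) : w.nonpos.FullSubcategory :=
  ⟨(w.exists_heart_triangle Y.property).choose_spec.choose,
    (w.exists_heart_triangle Y.property).choose_spec.choose_spec.choose_spec.choose_spec.choose_spec.2.2⟩

variable (Y : w.nonpos.FullSubcategory)

/-- The first morphism in a chosen distinguished triangle `Y ⟶ Q ⟶ W ⟶ Y⟦1⟧`. -/
noncomputable def heartπ : Y.obj ⟶ (heartApprox Y).obj :=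
  (w.exists_heart_triangle Y.property).choose_spec.choose_spec.choose

/-- The second morphism in a chosen distinguished triangle `Y ⟶ Q ⟶ W ⟶ Y⟦1⟧`. -/
noncomputable def heartConeι : (heartApprox Y).obj ⟶ (heartCone Y).obj :=
  (w.exists_heart_triangle Y.property).choose_spec.choose_spec.choose_spec.choose

/-- The third morphism in a chosen distinguished triangle `Y ⟶ Q ⟶ W ⟶ Y⟦1⟧`. -/
noncomputable def heartConeδ : (heartCone Y).obj ⟶ Y.obj⟦(1 : ℤ)⟧ :=
  (w.exists_heart_triangle Y.property).choose_spec.choose_spec.choose_spec.choose_spec.choose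

/-- The chosen distinguished triangle `Y ⟶ Q ⟶ W ⟶ Y⟦1⟧`. -/
noncomputable def heartTriangle : Triangle C :=
  Triangle.mk (heartπ Y) (heartConeι Y) (heartConeδ Y)

lemma heartTriangle_distinguished : heartTriangle Y ∈ distTriang C :=
  (w.exists_heart_triangle Y.property).choose_spec.choose_spec.choose_spec.choose_spec.choose_spec.1

lemma heartπ_comp_heartConeι : heartπ Y ≫ heartConeι Y = 0 :=
  comp_eq_zero_of_distTriang (heartTriangle_distinguished Y)

variable {Y}

lemma exists_heartπ_comp {Q : w.heart.FullSubcategory} (q : Y.obj ⟶ Q.obj) :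
    ∃ g : heartApprox Y ⟶ Q, heartπ Y ≫ g.hom = q := by
  obtain ⟨g, hg⟩ := exists_factor_of_distTriang (heartTriangle_distinguished Y)
    (heartCone Y).property Q.property.2 q
  exact ⟨ObjectProperty.homMk g, hg⟩

/-- The class `C_{t ≥ 0}` is left orthogonal to the fibre of `Y ⟶ Q`. -/
lemma eq_zero_of_comp_heartπ {B : C} (hB : (w.nonpos.shift (1 : ℤ)).leftOrthogonal B)
    (f : B ⟶ Y.obj) (hf : f ≫ heartπ Y = 0) : f = 0 := by
  obtain ⟨c, rfl⟩ := Triangle.coyoneda_exact₂ _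
    (inv_rot_of_distTriang _ (heartTriangle_distinguished Y)) f hf
  exact (congr_arg (· ≫ _) (hB c (w.nonpos_shift_shift (heartCone Y).property))).trans zero_comp

/-- The decisive test morphism is Q ⟶ W followed by the approximation of W: it vanishes on Y, and
morphisms B ⟶ W are detected by that approximation. -/
lemma exists_comp_heartπ_eq {B : C} (hB : (w.nonpos.shift (1 : ℤ)).leftOrthogonal B)
    (φ : B ⟶ (heartApprox Y).obj) (hφ : ∀ (Q : w.heart.FullSubcategory) (g : heartApprox Y ⟶ Q),
      heartπ Y ≫ g.hom = 0 → φ ≫ g.hom = 0) : ∃ f : B ⟶ Y.obj, f ≫ heartπ Y = φ := by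
  refine exists_lift_of_distTriang (heartTriangle_distinguished Y) φ
    (eq_zero_of_comp_heartπ hB _ ?_)
  rw [Category.assoc]
  refine hφ _ (ObjectProperty.homMk (heartConeι Y ≫ heartπ (heartCone Y))) ?_
  exact (Category.assoc _ _ _).symm.trans (by rw [heartπ_comp_heartConeι, zero_comp])

end HeartApproximation

section Products

variable [HasProducts.{v} C] {I : Type v}

/-- The product of a family of objects of the heart, computed in `C`. -/
noncomputable def heartPi (hw : w.IsCosmashing) (Q : I → w.heart.FullSubcategory) :
    w.heart.FullSubcategory :=
  ⟨∏ᶜ fun i ↦ (Q i).obj,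
    have := hw.heart_isClosedUnderLimitsOfShape I
    w.heart.prop_pi _ fun i ↦ (Q i).property⟩

/-- The projections from the product of a family of objects of the heart. -/
noncomputable def heartPiπ (hw : w.IsCosmashing) (Q : I → w.heart.FullSubcategory) (i : I) :
    heartPi hw Q ⟶ Q i :=
  ObjectProperty.homMk (Pi.π (fun i ↦ (Q i).obj) i)

lemma existsUnique_heartPi (F : w.heart.FullSubcategory ⥤ AddCommGrpCat.{v})
    [PreservesLimitsOfShape (Discrete I) F] (hw : w.IsCosmashing)
    (Q : I → w.heart.FullSubcategory) (y : ∀ i, F.obj (Q i)) :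
    ∃! x : F.obj (heartPi hw Q), ∀ i, F.map (heartPiπ hw Q i) x = y i := by
  let hlim : IsLimit (Fan.mk (heartPi hw Q) (heartPiπ hw Q)) :=
    isLimitOfIsLimitFanMkObj w.heart.ι _ _ (productIsProduct fun i ↦ (Q i).obj)
  exact existsUnique_of_preservesLimit F hlim y

end Products

/-! ### Right Kan extension from the heart to C_{w≤0}. -/

section RightExtension

variable (F : w.heart.FullSubcategory ⥤ AddCommGrpCat.{v})

/-- The values of the right Kan extension of `F` to `C_{w ≤ 0}`. -/
def rightExtObj (Y : w.nonpos.FullSubcategory) : AddSubgroup (F.obj (heartApprox Y)) where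
  carrier := {z | ∀ (Q : w.heart.FullSubcategory) (g : heartApprox Y ⟶ Q),
    heartπ Y ≫ g.hom = 0 → F.map g z = 0}
  zero_mem' Q g _ := map_zero _
  add_mem' hz hz' Q g hg := by rw [map_add, hz Q g hg, hz' Q g hg, add_zero]
  neg_mem' hz Q g hg := by rw [map_neg, hz Q g hg, neg_zero]

/-- The evaluation of an element of the right Kan extension at a morphism to the heart. -/
noncomputable def rightExtEval {Y : w.nonpos.FullSubcategory} {Q : w.heart.FullSubcategory}
    (q : Y.obj ⟶ Q.obj) : rightExtObj F Y →+ F.obj Q :=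
  (F.map (exists_heartπ_comp q).choose).hom.comp (rightExtObj F Y).subtype

variable [F.Additive] {Y Y' : w.nonpos.FullSubcategory} {Q Q' : w.heart.FullSubcategory}

/-- Two factorizations of q differ by a morphism that vanishes on Y, and such morphisms kill z. -/
lemma rightExtEval_eq (q : Y.obj ⟶ Q.obj) (g : heartApprox Y ⟶ Q) (hg : heartπ Y ≫ g.hom = q)
    (z : rightExtObj F Y) : rightExtEval F q z = F.map g z.1 := by
  rw [← sub_eq_zero]
  change F.map (exists_heartπ_comp q).choose z.1 - _ = 0
  rw [← map_sub_apply']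
  apply z.2
  change heartπ Y ≫ ((exists_heartπ_comp q).choose.hom - g.hom) = 0
  rw [Preadditive.comp_sub, (exists_heartπ_comp q).choose_spec, hg, sub_self]

lemma map_rightExtEval (q : Y.obj ⟶ Q.obj) (g : Q ⟶ Q') (z : rightExtObj F Y) :
    F.map g (rightExtEval F q z) = rightExtEval F (q ≫ g.hom) z := by
  obtain ⟨a, ha⟩ := exists_heartπ_comp q
  rw [rightExtEval_eq F q a ha, rightExtEval_eq F (q ≫ g.hom) (a ≫ g) (by simp [← ha]),
    map_comp_apply']

lemma rightExtEval_add (q q' : Y.obj ⟶ Q.obj) (z : rightExtObj F Y) :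
    rightExtEval F (q + q') z = rightExtEval F q z + rightExtEval F q' z := by
  obtain ⟨a, ha⟩ := exists_heartπ_comp q
  obtain ⟨b, hb⟩ := exists_heartπ_comp q'
  rw [rightExtEval_eq F q a ha, rightExtEval_eq F q' b hb, rightExtEval_eq F (q + q') (a + b),
    map_add_apply']
  rw [← ha, ← hb, ← Preadditive.comp_add]
  rfl

lemma rightExtEval_zero (z : rightExtObj F Y) :
    rightExtEval F (0 : Y.obj ⟶ Q.obj) z = 0 := by
  rw [rightExtEval_eq F 0 0 comp_zero, map_zero_apply']

lemma rightExtEval_sub (q q' : Y.obj ⟶ Q.obj) (z : rightExtObj F Y) :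
    rightExtEval F (q - q') z = rightExtEval F q z - rightExtEval F q' z := by
  rw [eq_sub_iff_add_eq, ← rightExtEval_add, sub_add_cancel]

lemma rightExtEval_heartπ (z : rightExtObj F Y) : rightExtEval F (heartπ Y) z = z.1 := by
  rw [rightExtEval_eq F (heartπ Y) (𝟙 _) (Category.comp_id _), map_id_apply']

lemma rightExtObj_ext (z z' : rightExtObj F Y)
    (h : ∀ (Q : w.heart.FullSubcategory) (q : Y.obj ⟶ Q.obj),
      rightExtEval F q z = rightExtEval F q z') : z = z' :=
  Subtype.ext (by rw [← rightExtEval_heartπ, ← rightExtEval_heartπ, h])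

/-- Any weak reflection p may replace the chosen one: this is applied to products of approximations
and to identities. -/
lemma exists_rightExtEval_eq (p : Y.obj ⟶ Q.obj)
    (hp : ∀ (Q' : w.heart.FullSubcategory) (q : Y.obj ⟶ Q'.obj), ∃ g : Q ⟶ Q', p ≫ g.hom = q)
    (x : F.obj Q) (hx : ∀ (Q' : w.heart.FullSubcategory) (g : Q ⟶ Q'),
      p ≫ g.hom = 0 → F.map g x = 0) :
    ∃ z : rightExtObj F Y, rightExtEval F p z = x := by
  obtain ⟨a, ha⟩ := hp _ (heartπ Y)
  obtain ⟨b, hb⟩ := exists_heartπ_comp p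
  refine ⟨⟨F.map a x, fun Q' g hg ↦ ?_⟩, ?_⟩
  · rw [← map_comp_apply']
    refine hx _ _ ?_
    rwa [ObjectProperty.FullSubcategory.comp_hom, ← Category.assoc, ha]
  · rw [rightExtEval_eq F p b hb, ← map_comp_apply', ← sub_eq_zero]
    nth_rewrite 2 [← map_id_apply' F x]
    rw [← map_sub_apply']
    refine hx _ _ ?_
    change p ≫ (a.hom ≫ b.hom - 𝟙 _) = 0
    rw [Preadditive.comp_sub, reassoc_of% ha, hb, Category.comp_id, sub_self]

/-- The map induced by a morphism between the values of the right Kan extension of `F`. -/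
noncomputable def rightExtMap (f : Y ⟶ Y') : rightExtObj F Y →+ rightExtObj F Y' :=
  (rightExtEval F (f.hom ≫ heartπ Y')).codRestrict _ fun z Q g hg ↦ by
    rw [map_rightExtEval, Category.assoc, hg, comp_zero, rightExtEval_zero]

lemma rightExtEval_map (f : Y ⟶ Y') (q : Y'.obj ⟶ Q.obj) (z : rightExtObj F Y) :
    rightExtEval F q (rightExtMap F f z) = rightExtEval F (f.hom ≫ q) z := by
  obtain ⟨g, rfl⟩ := exists_heartπ_comp q
  rw [rightExtEval_eq F _ g rfl]
  refine (map_rightExtEval F (f.hom ≫ heartπ Y') g z).trans ?_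
  rw [Category.assoc]

/-- The right Kan extension to `C_{w ≤ 0}` of a functor defined on the heart. -/
noncomputable def rightExt : w.nonpos.FullSubcategory ⥤ AddCommGrpCat.{v} where
  obj Y := AddCommGrpCat.of (rightExtObj F Y)
  map f := AddCommGrpCat.ofHom (rightExtMap F f)
  map_id Y := AddCommGrpCat.ext fun z ↦ rightExtObj_ext F _ _ fun Q q ↦
    (rightExtEval_map F (𝟙 Y) q z).trans (by
      rw [ObjectProperty.FullSubcategory.id_hom, Category.id_comp]; rfl)
  map_comp {X Y Z} f g := AddCommGrpCat.ext fun z ↦ rightExtObj_ext F _ _ fun Q q ↦ by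
    refine (rightExtEval_map F (f ≫ g) q z).trans
      (((rightExtEval_map F g q (rightExtMap F f z)).trans (rightExtEval_map F f _ z)).trans ?_).symm
    rw [ObjectProperty.FullSubcategory.comp_hom, Category.assoc]

instance : (rightExt F).Additive where
  map_add {Y Y' f g} := AddCommGrpCat.ext fun z ↦ rightExtObj_ext F _ _ fun Q q ↦ by
    change rightExtObj F Y at z
    refine (rightExtEval_map F (f + g) q z).trans ?_
    have : (f + g).hom ≫ q = f.hom ≫ q + g.hom ≫ q := Preadditive.add_comp _ _ _ _ _ _
    rw [this, rightExtEval_add]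
    refine Eq.trans ?_ (map_add (rightExtEval F q) (rightExtMap F f z) (rightExtMap F g z)).symm
    rw [rightExtEval_map, rightExtEval_map]

lemma isHalfExact_rightExt : IsHalfExact (rightExt F) := by
  intro X Y Z f g h hT (y : rightExtObj F Y) (hy : rightExtMap F g y = 0)
  have hy' (Q : w.heart.FullSubcategory) (q : Z.obj ⟶ Q.obj) :
      rightExtEval F (g.hom ≫ q) y = 0 := by
    rw [← rightExtEval_map, hy, map_zero]
  -- The approximation of X extends to r on Y because Z is in C_{w≤0}; the preimage of y is its
  -- evaluation at r. Errors vanish on X, so they factor through Z, where y evaluates to zero.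
  obtain ⟨r, hr⟩ := exists_factor_of_distTriang hT Z.property (heartApprox X).property.2 (heartπ X)
  let x : rightExtObj F X := ⟨rightExtEval F r y, fun Q a ha ↦ by
    obtain ⟨b, hb⟩ := exists_desc_of_distTriang hT (r ≫ a.hom) (by rw [reassoc_of% hr, ha])
    rw [map_rightExtEval, ← hb, hy']⟩
  refine ⟨x, rightExtObj_ext F (rightExtMap F f x) y fun Q q ↦ ?_⟩
  obtain ⟨a, ha⟩ := exists_heartπ_comp (f.hom ≫ q)
  obtain ⟨b, hb⟩ := exists_desc_of_distTriang hT (q - r ≫ a.hom) (by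
    rw [Preadditive.comp_sub, reassoc_of% hr, ha, sub_self])
  rw [rightExtEval_map, rightExtEval_eq F _ a ha]
  refine (map_rightExtEval F r a y).trans ?_
  rw [eq_comm, ← sub_eq_zero, ← rightExtEval_sub, ← hb, hy']

section Products

variable [HasProducts.{v} C] {I : Type v} (L : I → w.nonpos.FullSubcategory)

lemma exists_map_heartπ_comp (hw : w.IsCosmashing) {Q : C} (hQ : w.nonneg Q)
    (q : (∏ᶜ fun i ↦ (L i).obj) ⟶ Q) :
    ∃ g : (∏ᶜ fun i ↦ (heartApprox (L i)).obj) ⟶ Q,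
      Limits.Pi.map (fun i ↦ heartπ (L i)) ≫ g = q := by
  have := hw.2 I
  exact exists_factor_of_distTriang
    (productTriangle_distinguished _ fun i ↦ heartTriangle_distinguished (L i))
    (w.nonpos.prop_pi _ fun i ↦ (heartCone (L i)).property) hQ q

lemma exists_map_heartConeι_comp {Q : C} (q : (∏ᶜ fun i ↦ (heartApprox (L i)).obj) ⟶ Q)
    (hq : Limits.Pi.map (fun i ↦ heartπ (L i)) ≫ q = 0) :
    ∃ g : (∏ᶜ fun i ↦ (heartCone (L i)).obj) ⟶ Q,
      Limits.Pi.map (fun i ↦ heartConeι (L i)) ≫ g = q :=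
  exists_desc_of_distTriang
    (productTriangle_distinguished _ fun i ↦ heartTriangle_distinguished (L i)) q hq

lemma respectsProducts_rightExt (hw : w.IsCosmashing)
    (hF : ∀ I : Type v, PreservesLimitsOfShape (Discrete I) F) :
    RespectsProducts (rightExt F) := by
  intro I L
  have := hF I
  have := hw.2 I
  let E : w.nonpos.FullSubcategory :=
    ⟨∏ᶜ fun i ↦ (L i).obj, w.nonpos.prop_pi _ fun i ↦ (L i).property⟩
  let π (i : I) : E ⟶ L i := ObjectProperty.homMk (Pi.π (fun i ↦ (L i).obj) i)
  let Q := heartPi hw fun i ↦ heartApprox (L i)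
  let p : E.obj ⟶ Q.obj := Limits.Pi.map fun i ↦ heartπ (L i)
  have hπ (i : I) : p ≫ (heartPiπ hw (fun i ↦ heartApprox (L i)) i).hom =
      (π i).hom ≫ heartπ (L i) :=
    Limits.Pi.map_π _ _
  have hp (Q' : w.heart.FullSubcategory) (q : E.obj ⟶ Q'.obj) : ∃ g : Q ⟶ Q', p ≫ g.hom = q := by
    obtain ⟨g, hg⟩ := exists_map_heartπ_comp L hw Q'.property.2 q
    exact ⟨ObjectProperty.homMk g, hg⟩
  refine ⟨E, π, ⟨productIsProduct _⟩, fun (y : ∀ i, rightExtObj F (L i)) ↦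
    existsUnique_of_exists_of_unique ?_ ?_⟩
  · obtain ⟨x, hx, -⟩ := existsUnique_heartPi F hw (fun i ↦ heartApprox (L i)) fun i ↦ (y i).1
    obtain ⟨z, hz⟩ := exists_rightExtEval_eq F p hp x fun Q' g hg ↦ by
      -- A morphism vanishing on the product of the L i factors through the product of their cones,
      -- then through the product of the approximations of the cones; so F(g) factors through F(κ),
      -- which kills x componentwise.
      obtain ⟨h, hh⟩ := exists_map_heartConeι_comp L g.hom hg
      obtain ⟨h', rfl⟩ := exists_map_heartπ_comp (fun i ↦ heartCone (L i)) hw Q'.property.2 h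
      let k (i : I) : heartApprox (L i) ⟶ heartApprox (heartCone (L i)) :=
        ObjectProperty.homMk (heartConeι (L i) ≫ heartπ (heartCone (L i)))
      let κ : Q ⟶ heartPi hw fun i ↦ heartApprox (heartCone (L i)) :=
        ObjectProperty.homMk (Limits.Pi.map fun i ↦ (k i).hom)
      have hκ (i : I) : κ ≫ heartPiπ hw _ i = heartPiπ hw _ i ≫ k i := by
        ext
        exact Limits.Pi.map_π (fun i ↦ (k i).hom) i
      have hk : Limits.Pi.map (fun i ↦ heartConeι (L i)) ≫
          Limits.Pi.map (fun i ↦ heartπ (heartCone (L i))) = Limits.Pi.map fun i ↦ (k i).hom :=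
        Limits.Pi.hom_ext _ _ fun i ↦ by simp [k]
      have hg' : g = κ ≫ ObjectProperty.homMk h' := by
        ext
        refine hh.symm.trans ((Category.assoc _ _ _).symm.trans ?_)
        exact congr_arg (· ≫ h') hk
      have hκx : F.map κ x = 0 := by
        refine (existsUnique_heartPi F hw (fun i ↦ heartApprox (heartCone (L i)))
          fun _ ↦ 0).unique (fun i ↦ ?_) fun i ↦ map_zero _
        rw [← map_comp_apply', hκ, map_comp_apply', hx]
        refine (y i).2 _ (k i) ?_
        exact (Category.assoc _ _ _).symm.trans (by rw [heartπ_comp_heartConeι, zero_comp])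
      rw [hg', map_comp_apply', hκx, map_zero]
    refine ⟨z, fun i ↦ Subtype.ext (a1 := rightExtMap F (π i) z) (Eq.trans ?_ (hx i))⟩
    rw [← rightExtEval_heartπ, ← hz, map_rightExtEval, hπ, rightExtEval_map]
  · intro (z : rightExtObj F E) (z' : rightExtObj F E) hz hz'
    replace hz (i : I) : rightExtMap F (π i) z = rightExtMap F (π i) z' :=
      (hz i).trans (hz' i).symm
    have h : rightExtEval F p z = rightExtEval F p z' := by
      refine (existsUnique_heartPi F hw (fun i ↦ heartApprox (L i))
        (fun i ↦ rightExtEval F (heartπ (L i)) (rightExtMap F (π i) z'))).unique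
        (fun i ↦ ?_) fun i ↦ ?_
      · rw [map_rightExtEval, hπ, ← rightExtEval_map, hz]
      · rw [map_rightExtEval, hπ, ← rightExtEval_map]
    refine rightExtObj_ext F z z' fun Q' q ↦ ?_
    obtain ⟨g, rfl⟩ := hp Q' q
    rw [← map_rightExtEval, ← map_rightExtEval, h]

end Products

lemma bijective_rightExtEval_id (Q : w.heart.FullSubcategory) :
    Function.Bijective (rightExtEval F (Y := ⟨Q.obj, Q.property.1⟩) (𝟙 Q.obj)) := by
  refine ⟨fun z z' h ↦ rightExtObj_ext F _ _ fun Q' q ↦ ?_, fun x ↦ ?_⟩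
  · have (z : rightExtObj F ⟨Q.obj, Q.property.1⟩) :
        F.map (ObjectProperty.homMk q : Q ⟶ Q') (rightExtEval F (𝟙 Q.obj) z) =
          rightExtEval F q z :=
      (map_rightExtEval F _ _ z).trans (by rw [Category.id_comp]; rfl)
    rw [← this, ← this, h]
  · refine exists_rightExtEval_eq F _ (fun Q' q ↦ ⟨ObjectProperty.homMk q, Category.id_comp q⟩) x
      fun Q' g hg ↦ ?_
    obtain rfl : g = 0 := by
      ext
      exact (Category.id_comp _).symm.trans hg
    exact map_zero_apply' F x

lemma heart_le_nonpos (w : WeightStructure C) : w.heart ≤ w.nonpos := fun _ h ↦ h.1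

/-- The right Kan extension restricts to the original functor. -/
noncomputable def rightExtIso : ObjectProperty.ιOfLE w.heart_le_nonpos ⋙ rightExt F ≅ F :=
  let e (Q : w.heart.FullSubcategory) : rightExtObj F ⟨Q.obj, Q.property.1⟩ ≃+ F.obj Q :=
    AddEquiv.ofBijective (rightExtEval F (𝟙 Q.obj)) (bijective_rightExtEval_id F Q)
  NatIso.ofComponents (fun Q ↦ (e Q).toAddCommGrpIso) fun {Q Q'} f ↦ AddCommGrpCat.ext fun z ↦ by
    refine (rightExtEval_map F ((ObjectProperty.ιOfLE w.heart_le_nonpos).map f) (𝟙 Q'.obj) z).trans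
      ((map_rightExtEval F (𝟙 Q.obj) f z).trans ?_).symm
    exact congr_arg (fun q ↦ rightExtEval F (Y := ⟨Q.obj, Q.property.1⟩) (Q := Q') q z)
      ((Category.id_comp f.hom).trans (Category.comp_id f.hom).symm)

lemma rightExt_eq_zero (hY : w.nonpos (Y.obj⟦(1 : ℤ)⟧)) (z : rightExtObj F Y) : z = 0 := by
  apply Subtype.ext
  rw [← rightExtEval_heartπ, w.hom_eq_zero (heartπ Y) hY (heartApprox Y).property.2,
    rightExtEval_zero]
  rfl

end RightExtension

/-! ### The heart of the t-structure as a functor category. -/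

section Heart

lemma IsCosmashing.productPreserving_coyoneda (hw : w.IsCosmashing) (B : C) :
    w.productPreserving (w.heart.ι ⋙ preadditiveCoyoneda.obj (Opposite.op B)) := by
  refine ⟨inferInstance, fun I ↦ ?_⟩
  have := hw.1
  have := hw.heart_isClosedUnderLimitsOfShape I
  have : PreservesLimitsOfShape (Discrete I) w.heart.ι := inferInstance
  have : PreservesLimitsOfShape (Discrete I) (preadditiveCoyoneda.obj (Opposite.op B)) :=
    inferInstance
  infer_instance

variable (hw : w.IsCosmashing) (hC : DualBrownRepresentability C)

lemma heart_rightAdjacentTStructure_iff (B : C) :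
    (rightAdjacentTStructure hw hC).heart B ↔
      (w.nonpos.shift (1 : ℤ)).leftOrthogonal B ∧ w.nonpos B := by
  have h : w.nonpos.shift (0 : ℤ) B ↔ w.nonpos B := by rw [ObjectProperty.shift_zero]
  exact and_congr Iff.rfl h

/-- The functor that sends an object of the heart of the right adjacent `t`-structure to the functor
it corepresents on the heart of `w`. -/
noncomputable def heartCoyoneda :
    (rightAdjacentTStructure hw hC).heart.FullSubcategoryᵒᵖ ⥤
      w.productPreserving.FullSubcategory :=
  w.productPreserving.lift
    ((rightAdjacentTStructure hw hC).heart.ι.op ⋙ preadditiveCoyoneda ⋙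
      (Functor.whiskeringLeft _ _ _).obj w.heart.ι)
    fun B ↦ hw.productPreserving_coyoneda B.unop.obj

instance : (heartCoyoneda hw hC).Faithful where
  map_injective {B B'} f g hfg := by
    apply Quiver.Hom.unop_inj
    ext
    have hB := ((heart_rightAdjacentTStructure_iff hw hC _).1 B.unop.property).2
    have hB' := ((heart_rightAdjacentTStructure_iff hw hC _).1 B'.unop.property).1
    let Y : w.nonpos.FullSubcategory := ⟨B.unop.obj, hB⟩
    rw [← sub_eq_zero]
    refine eq_zero_of_comp_heartπ (Y := Y) hB' _ ?_
    rw [Preadditive.sub_comp, sub_eq_zero]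
    exact ConcreteCategory.congr_hom (congr_app (congr_arg (·.hom) hfg) (heartApprox Y)) (heartπ Y)

instance : (heartCoyoneda hw hC).Full where
  map_surjective {B B'} τ := by
    have hB := ((heart_rightAdjacentTStructure_iff hw hC _).1 B.unop.property).2
    have hB' := ((heart_rightAdjacentTStructure_iff hw hC _).1 B'.unop.property).1
    let Y : w.nonpos.FullSubcategory := ⟨B.unop.obj, hB⟩
    let φ (Q : w.heart.FullSubcategory) : (B.unop.obj ⟶ Q.obj) →+ (B'.unop.obj ⟶ Q.obj) :=
      (τ.hom.app Q).hom
    have hφ {Q Q' : w.heart.FullSubcategory} (q : B.unop.obj ⟶ Q.obj) (g : Q ⟶ Q') :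
        φ Q' (q ≫ g.hom) = φ Q q ≫ g.hom :=
      ConcreteCategory.congr_hom (τ.hom.naturality g) q
    -- A Yoneda argument with the weak reflection `heartπ Y` in place of the identity of B, which
    -- need not lie in the heart of w.
    obtain ⟨f, hf⟩ := exists_comp_heartπ_eq (Y := Y) hB' (φ _ (heartπ Y)) fun Q g hg ↦ by
      rw [← hφ, hg, map_zero]
    refine ⟨Quiver.Hom.op (ObjectProperty.homMk f), ?_⟩
    ext Q (q : B.unop.obj ⟶ Q.obj)
    change f ≫ q = φ Q q
    obtain ⟨g, rfl⟩ := exists_heartπ_comp (Y := Y) q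
    rw [hφ, ← hf, Category.assoc]

instance : (heartCoyoneda hw hC).EssSurj where
  mem_essImage F := by
    have := hw.1
    have := F.property.1
    obtain ⟨B, hB, ⟨e⟩⟩ := exists_corepresenting_object hC (isHalfExact_rightExt F.obj)
      (respectsProducts_rightExt F.obj hw F.property.2)
    -- The right extension vanishes on C_{w≤-1}, which is left orthogonal to the heart of w; hence B
    -- lies in t_{≥0}.
    have hB' : (w.nonpos.shift (1 : ℤ)).leftOrthogonal B := by
      intro X f hX
      let Y : w.nonpos.FullSubcategory := ⟨X, by
        rw [← w.nonpos.shift_zero ℤ, ← w.nonpos.shift_shift 1 (-1) 0 (by lia)]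
        exact w.nonpos_shift hX⟩
      apply (bijective_of_iso_app e (Y := Y) fun _ ↦ rfl).1
      exact (rightExt_eq_zero F.obj (Y := Y) hX _).trans
        (rightExt_eq_zero F.obj (Y := Y) hX _).symm
    exact ⟨Opposite.op ⟨B, (heart_rightAdjacentTStructure_iff hw hC B).2 ⟨hB', hB⟩⟩,
      ⟨w.productPreserving.fullyFaithfulι.preimageIso
        (Functor.isoWhiskerLeft (ObjectProperty.ιOfLE w.heart_le_nonpos) e ≪≫
          rightExtIso F.obj)⟩⟩

instance : (heartCoyoneda hw hC).IsEquivalence where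

end Heart

end WeightStructure

end WeightT

theorem mainTheorem5 {C : Type u} [Category.{v} C] [Preadditive C] [HasZeroObject C]
    [HasShift C ℤ] [∀ n : ℤ, (shiftFunctor C n).Additive] [Pretriangulated C] [IsTriangulated C]
    (w : WeightT.WeightStructure C) (hw : w.IsCosmashing)
    (hC : WeightT.DualBrownRepresentability C) :
    ∃ (_ : HasCoproducts.{v} C) (t : TStructure C),
      WeightT.IsSmashingTStructure t ∧
      WeightT.RightAdjacent w t ∧
      Nonempty (t.heart.FullSubcategoryᵒᵖ ≌ w.productPreserving.FullSubcategory) ∧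
      ∀ α : Cardinal.{v}, Cardinal.aleph0 ≤ α →
        ∃ _ : (WeightT.smallObjects C α).IsTriangulated,
          w.IsSmashing →
            ∃ _ : (WeightT.smallObjects C α).HasInducedTStructure t,
              WeightT.AntiOrthogonal (WeightT.smallObjects C α).ι w
                ((WeightT.smallObjects C α).tStructure t) ∧
              ∀ t' : TStructure (WeightT.smallObjects C α).FullSubcategory,
                WeightT.AntiOrthogonal (WeightT.smallObjects C α).ι w t' →
                  t' = (WeightT.smallObjects C α).tStructure t := by
  have := hC.hasCoproducts
  have hsmall (α : Cardinal.{v}) (hα : Cardinal.aleph0 ≤ α) :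
      (WeightT.smallObjects C α).IsTriangulated := by
    rw [WeightT.smallObjects_eq_factorsThroughSmall hα]
    exact WeightT.factorsThroughSmall_isTriangulated hα
  have h := WeightT.WeightStructure.antiOrthogonal_rightAdjacentTStructure hw hC
  refine ⟨this, WeightT.WeightStructure.rightAdjacentTStructure hw hC,
    WeightT.WeightStructure.isSmashing_rightAdjacentTStructure hw hC, h,
    ⟨(WeightT.WeightStructure.heartCoyoneda hw hC).asEquivalence⟩, fun α hα ↦ ?_⟩
  have := hsmall α hα
  refine ⟨this, fun hw' ↦ ?_⟩
  have := hw'.hasInducedTStructure hw hC hα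
  exact ⟨this, ⟨fun X ↦ h.1 X.obj, fun X ↦ h.2 X.obj⟩,
    fun t' ht' ↦ WeightT.WeightStructure.eq_of_antiOrthogonal hw hC _ t' ht'⟩
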